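/- Let $n\ge 1$, let $\mathbb D^n$ be the open unit polydisc, and let $H^2(\mathbb D^n)$ be the Hilbert space of all holomorphic functions $f$ on $\mathbb D^n$ with $\|f\|^2=\sup_{0\le r<1}\int_{\mathbb T^n}|f(r\zeta)|^2\,dm(\zeta)<\infty$, where $m$ is the normalized Lebesgue measure on the torus $\mathbb T^n$. Let $M_{z_i}$ denote multiplication by the coordinate $z_i$. A closed subspace $\mathcal Q\subseteq H^2(\mathbb D^n)$ is a quotient module if $M_{z_i}\mathcal Q^\perp\subseteq\mathcal Q^\perp$ for all $i$; a quotient module is doubly commuting if the compressions $C_{z_i}=P_{\mathcal Q}M_{z_i}|_{\mathcal Q}$ satisfy $C_{z_i}C_{z_j}^*=C_{z_j}^*C_{z_i}$ for all $1\le i<j\le n$. For $\Theta\in H^\infty(\mathbb D)$ put $\mathcal Q_\Theta=H^2(\mathbb D)\ominus\Theta H^2(\mathbb D)$ (so $\mathcal Q_0=H^2(\mathbb D)$). $\Theta\in H^\infty(\mathbb D)$ is inner if its radial limits exist and have modulus $1$ almost everywhere on $\mathbb T$. For closed subspaces $\mathcal Q_1,\dots,\mathcal Q_n$ of $H^2(\mathbb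 D)$, the Hilbert space tensor product $\mathcal Q_1\otimes\cdots\otimes\mathcal Q_n$ is identified with the closed linear span in $H^2(\mathbb D^n)$ of the functions $z\mapsto f_1(z_1)\cdots f_n(z_n)$ with $f_i\in\mathcal Q_i$. Then a closed subspace $\mathcal Q$ of $H^2(\mathbb D^n)$ is a doubly commuting quotient module if and only if there exist $\Theta_1,\dots,\Theta_n\in H^\infty(\mathbb D)$, each of which is either inner or identically zero, such that $$\mathcal Q=\mathcal Q_{\Theta_1}\otimes\cdots\otimes\mathcal Q_{\Theta_n}.$$ -/

import Mathlib

open MeasureTheory Filter Topology Set UnitAddTorus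

noncomputable section
namespace Hardy

/-- The open unit polydisc `𝔻ⁿ`. -/
def polydisc (n : ℕ) : Set (Fin n → ℂ) := {z | ∀ i, ‖z i‖ < 1}

/-- The normalized Lebesgue measure on the torus `𝕋ⁿ`, parametrized by `(ℝ/ℤ)ⁿ`. -/
def torusMeasure (n : ℕ) : Measure (UnitAddTorus (Fin n)) :=
  Measure.pi fun _ => AddCircle.haarAddCircle

/-- The point `(ρ₁ ζ₁, …, ρₙ ζₙ)` where `ζⱼ = e^{2πi tⱼ}`. -/
def torusPoint {n : ℕ} (ρ : Fin n → ℝ) (t : UnitAddTorus (Fin n)) : Fin n → ℂ :=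
  fun i => (ρ i : ℂ) * (AddCircle.toCircle (t i) : ℂ)

instance (n : ℕ) : IsProbabilityMeasure (torusMeasure n) := by
  unfold torusMeasure; infer_instance

instance (n : ℕ) : (torusMeasure n).IsAddLeftInvariant := by
  unfold torusMeasure; infer_instance

instance (n : ℕ) : (torusMeasure n).IsAddRightInvariant := by
  unfold torusMeasure; infer_instance

theorem polydisc_eq_ball (n : ℕ) : polydisc n = Metric.ball 0 1 := by
  ext z
  simp [polydisc, pi_norm_lt_iff]

theorem isOpen_polydisc (n : ℕ) : IsOpen (polydisc n) := by
  rw [polydisc_eq_ball]; exact Metric.isOpen_ball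

theorem norm_torusPoint {n : ℕ} (ρ : Fin n → ℝ) (t) (i) : ‖torusPoint ρ t i‖ = |ρ i| := by
  rw [torusPoint, norm_mul, Circle.norm_coe, Complex.norm_real, mul_one, Real.norm_eq_abs]

theorem torusPoint_mem {n : ℕ} {ρ : Fin n → ℝ} (hρ : ∀ i, ρ i ∈ Ico (0 : ℝ) 1) (t) :
    torusPoint ρ t ∈ polydisc n := fun i => by
  rw [norm_torusPoint, abs_of_nonneg (hρ i).1]; exact (hρ i).2

theorem continuous_torusPoint {n : ℕ} (ρ : Fin n → ℝ) : Continuous (torusPoint ρ) := by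
  unfold torusPoint; fun_prop

theorem continuous_comp_torusPoint {n : ℕ} {f : (Fin n → ℂ) → ℂ}
    (hf : ContinuousOn f (polydisc n)) {ρ : Fin n → ℝ} (hρ : ∀ i, ρ i ∈ Ico (0 : ℝ) 1) :
    Continuous fun t => f (torusPoint ρ t) :=
  hf.comp_continuous (continuous_torusPoint ρ) (torusPoint_mem hρ)

theorem mFourierCoeff_eq {n : ℕ} (f : UnitAddTorus (Fin n) → ℂ) (k : Fin n → ℤ) :
    mFourierCoeff f k = ∫ t, mFourier (-k) t • f t ∂(torusMeasure n) := rfl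

theorem hasSum_sq_coeff {n : ℕ} {g : UnitAddTorus (Fin n) → ℂ} (hg : Continuous g) :
    HasSum (fun k => ‖mFourierCoeff g k‖ ^ 2) (∫ t, ‖g t‖ ^ 2 ∂(torusMeasure n)) := by
  have h := hasSum_sq_mFourierCoeff
    (ContinuousMap.toLp 2 (torusMeasure n) ℂ (⟨g, hg⟩ : C(UnitAddTorus (Fin n), ℂ)))
  convert! h using 1
  · ext k
    rw [show mFourierCoeff g k = _ from (mFourierCoeff_toLp ⟨g, hg⟩ k).symm]
    rfl
  · refine integral_congr_ae ?_
    filter_upwards [ContinuousMap.coeFn_toLp (p := 2) (𝕜 := ℂ) (torusMeasure n) ⟨g, hg⟩] with t ht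
    exact congrArg (fun x : ℂ => ‖x‖ ^ 2) ht.symm

/-- The Fourier coefficients of a one-variable holomorphic function on a circle. -/
theorem exists_coeff_one {g : ℂ → ℂ} (hg : DifferentiableOn ℂ g (Metric.ball 0 1)) (m : ℤ)
    {s : ℝ} (hs : s ∈ Ico (0 : ℝ) 1) :
    fourierCoeff (fun θ : UnitAddCircle => g (s * (AddCircle.toCircle θ : ℂ))) m =
      if m < 0 then 0 else (s : ℂ) ^ m.toNat *
        ((m.toNat.factorial : ℂ)⁻¹ * iteratedDeriv m.toNat g 0) := by
  set a : ℕ → ℂ := fun j => (j.factorial : ℂ)⁻¹ * iteratedDeriv j g 0 with ha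
  have hser : ∀ z ∈ Metric.ball (0 : ℂ) 1, HasSum (fun j : ℕ => z ^ j * a j) (g z) := by
    intro z hz
    have := Complex.hasSum_taylorSeries_on_ball (r := 1) (c := 0) (by simpa using hg) (by simpa using hz)
    refine HasSum.congr_fun this fun j => ?_
    simp only [a, smul_eq_mul, sub_zero]; ring
  have hsum : Summable fun j : ℕ => ‖(s : ℂ) ^ j * a j‖ :=
    (hser s (by simpa [abs_of_nonneg hs.1] using hs.2)).summable.norm
  have key : HasSum (fun j : ℕ => ∫ θ : UnitAddCircle, fourier (-m) θ •
      ((s * (AddCircle.toCircle θ : ℂ)) ^ j * a j) ∂AddCircle.haarAddCircle)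
      (fourierCoeff (fun θ : UnitAddCircle => g (s * (AddCircle.toCircle θ : ℂ))) m) := by
    have := hasSum_integral_of_summable_integral_norm (μ := AddCircle.haarAddCircle)
      (F := fun (j : ℕ) (θ : UnitAddCircle) =>
        fourier (-m) θ • ((s * (AddCircle.toCircle θ : ℂ)) ^ j * a j)) ?_ ?_
    · convert! this using 1
      refine integral_congr_ae (Eventually.of_forall fun θ => ?_)
      have h1 := hser (s * (AddCircle.toCircle θ : ℂ)) (by
        rw [mem_ball_zero_iff, norm_mul, Circle.norm_coe, mul_one, Complex.norm_real,
          Real.norm_eq_abs, abs_of_nonneg hs.1]; exact hs.2)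
      exact ((h1.const_smul (fourier (-m) θ)).tsum_eq).symm
    · intro j
      refine Continuous.integrable_of_hasCompactSupport (by fun_prop) ?_
      exact HasCompactSupport.of_compactSpace _
    · refine hsum.congr fun j => ?_
      rw [integral_congr_ae (g := fun _ => ‖(s : ℂ) ^ j * a j‖)]
      · simp
      · refine Eventually.of_forall fun θ => ?_
        simp only [norm_smul, norm_mul, norm_pow, fourier_apply, Circle.norm_coe, mul_one, one_mul]
  have hterm : ∀ j : ℕ, ∫ θ : UnitAddCircle, fourier (-m) θ •
      ((s * (AddCircle.toCircle θ : ℂ)) ^ j * a j) ∂AddCircle.haarAddCircle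
      = if (j : ℤ) = m then (s : ℂ) ^ j * a j else 0 := by
    intro j
    have h2 := congrFun (fourierCoeff_fourier (T := 1) (j : ℤ)) m
    have h3 : ∀ θ : UnitAddCircle, (AddCircle.toCircle θ : ℂ) ^ j = fourier (j : ℤ) θ := by
      intro θ
      simp [fourier_apply, AddCircle.toCircle_nsmul]
    simp_rw [mul_pow, h3]
    have : ∀ θ : UnitAddCircle, fourier (-m) θ • ((s : ℂ) ^ j * fourier (j : ℤ) θ * a j)
       = ((s : ℂ) ^ j * a j) • (fourier (-m) θ • fourier (j : ℤ) θ) := by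
      intro θ; simp only [smul_eq_mul]; ring
    simp_rw [this]
    rw [integral_smul]
    unfold fourierCoeff at h2
    rw [h2]
    simp [Pi.single_apply, eq_comm]
  simp_rw [hterm] at key
  refine key.unique ?_
  split_ifs with hm
  · convert! hasSum_zero using 2
    rw [if_neg (by omega)]
  · lift m to ℕ using not_lt.mp hm
    have := hasSum_ite_eq m ((s : ℂ) ^ m * a m)
    simp only [Int.toNat_natCast]
    convert this using 2 with j
    by_cases h : j = m <;> simp [h]
    
theorem mFourier_add_single {n : ℕ} (k : Fin n → ℤ) (t : UnitAddTorus (Fin n)) (i : Fin n)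
    (θ : UnitAddCircle) :
    mFourier k (t + Pi.single i θ) = mFourier k t * fourier (k i) θ := by
  have h : ∀ j, fourier (k j) ((t + Pi.single i θ : UnitAddTorus (Fin n)) j) =
      fourier (k j) (t j) * (if j = i then fourier (k i) θ else 1) := by
    intro j
    rcases eq_or_ne j i with rfl | hj
    · simp [fourier_apply, smul_add, AddCircle.toCircle_add]
    · simp [hj]
  simp only [mFourier, ContinuousMap.coe_mk, h, Finset.prod_mul_distrib]
  simp

theorem torusPoint_add_single {n : ℕ} (ρ : Fin n → ℝ) (t : UnitAddTorus (Fin n)) (i : Fin n)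
    (s : ℝ) (θ : UnitAddCircle) :
    torusPoint (Function.update ρ i s) (t + Pi.single i θ) = Function.update (torusPoint ρ t) i
      (s * (AddCircle.toCircle θ : ℂ) * (AddCircle.toCircle (t i) : ℂ)) := by
  funext j
  rcases eq_or_ne j i with rfl | hj
  · simp only [torusPoint, Function.update_self, Pi.add_apply, Pi.single_eq_same,
      AddCircle.toCircle_add, Circle.coe_mul]
    ring
  · simp [torusPoint, hj]

theorem exists_coeff_update {n : ℕ} {f : (Fin n → ℂ) → ℂ} (hf : DifferentiableOn ℂ f (polydisc n))
    {ρ : Fin n → ℝ} (hρ : ∀ i, ρ i ∈ Ico (0 : ℝ) 1) (k : Fin n → ℤ) (i : Fin n) :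
    ∃ C : ℂ, ∀ s ∈ Ico (0 : ℝ) 1,
      mFourierCoeff (fun t => f (torusPoint (Function.update ρ i s) t)) k =
        if k i < 0 then 0 else (s : ℂ) ^ (k i).toNat * C := by
  set g : UnitAddTorus (Fin n) → ℂ → ℂ := fun t w =>
    f (Function.update (torusPoint ρ t) i (w * (AddCircle.toCircle (t i) : ℂ))) with hgdef
  have hg : ∀ t, DifferentiableOn ℂ (g t) (Metric.ball 0 1) := by
    intro t
    refine hf.comp (t := polydisc n) (f := fun w : ℂ => Function.update (torusPoint ρ t) i
      (w * (AddCircle.toCircle (t i) : ℂ))) ?_ ?_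
    · refine Differentiable.differentiableOn ?_
      rw [differentiable_pi]
      intro j
      rcases eq_or_ne j i with rfl | hj
      · simp only [Function.update_self]; fun_prop
      · simp only [Function.update_of_ne hj]; fun_prop
    · intro w hw j
      beta_reduce
      rcases eq_or_ne j i with rfl | hj
      · rw [Function.update_self, norm_mul, Circle.norm_coe, mul_one]
        simpa using hw
      · rw [Function.update_of_ne hj]; exact torusPoint_mem hρ t j
  set c : UnitAddTorus (Fin n) → ℂ := fun t =>
    (((k i).toNat.factorial : ℂ)⁻¹ * iteratedDeriv (k i).toNat (g t) 0) with hc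
  refine ⟨∫ t, mFourier (-k) t * c t ∂(torusMeasure n), fun s hs => ?_⟩
  have hρs : ∀ j, Function.update ρ i s j ∈ Ico (0 : ℝ) 1 := by
    intro j
    rcases eq_or_ne j i with rfl | hj
    · simpa using hs
    · simpa [hj] using hρ j
  set F : UnitAddTorus (Fin n) → ℂ := fun t =>
    mFourier (-k) t * f (torusPoint (Function.update ρ i s) t) with hF
  have hFc : Continuous F :=
    (map_continuous _).mul (continuous_comp_torusPoint hf.continuousOn hρs)
  have hFs : ∀ t θ, F (t + Pi.single i θ) = mFourier (-k) t *
      (fourier (-(k i)) θ • g t (s * (AddCircle.toCircle θ : ℂ))) := by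
    intro t θ
    simp only [hF, mFourier_add_single, torusPoint_add_single, hgdef, Pi.neg_apply, smul_eq_mul]
    ring
  have h1 : mFourierCoeff (fun t => f (torusPoint (Function.update ρ i s) t)) k
      = ∫ t, F t ∂(torusMeasure n) := rfl
  have h2 : ∫ t, F t ∂(torusMeasure n) = ∫ θ : UnitAddCircle, ∫ t, F (t + Pi.single i θ)
      ∂(torusMeasure n) ∂AddCircle.haarAddCircle := by
    simp_rw [integral_add_right_eq_self F]
    simp
  have hc2 : Continuous (Function.uncurry fun (θ : UnitAddCircle) (t : UnitAddTorus (Fin n)) =>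
      F (t + Pi.single i θ)) := by
    refine hFc.comp ?_
    exact continuous_snd.add ((continuous_single i).comp continuous_fst)
  have h3 : ∫ θ : UnitAddCircle, ∫ t, F (t + Pi.single i θ)
      ∂(torusMeasure n) ∂AddCircle.haarAddCircle = ∫ t, ∫ θ : UnitAddCircle, F (t + Pi.single i θ)
      ∂AddCircle.haarAddCircle ∂(torusMeasure n) := by
    refine integral_integral_swap ?_
    exact hc2.integrable_of_hasCompactSupport (HasCompactSupport.of_compactSpace _)
  have h4 : ∀ t, ∫ θ : UnitAddCircle, F (t + Pi.single i θ) ∂AddCircle.haarAddCircle =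
      mFourier (-k) t * (if k i < 0 then 0 else (s : ℂ) ^ (k i).toNat * c t) := by
    intro t
    simp_rw [hFs, integral_const_mul]
    congr 1
    exact exists_coeff_one (hg t) (k i) hs
  rw [h1, h2, h3]
  simp_rw [h4]
  split_ifs with hk
  · simp
  · rw [← integral_const_mul]
    congr 1
    funext t
    ring

/-- Coefficients with a negative index vanish. -/
theorem coeff_neg {n : ℕ} {f : (Fin n → ℂ) → ℂ} (hf : DifferentiableOn ℂ f (polydisc n))
    {ρ : Fin n → ℝ} (hρ : ∀ i, ρ i ∈ Ico (0 : ℝ) 1) (k : Fin n → ℤ) (hk : ∃ i, k i < 0) :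
    mFourierCoeff (fun t => f (torusPoint ρ t)) k = 0 := by
  obtain ⟨i, hi⟩ := hk
  obtain ⟨C, hC⟩ := exists_coeff_update hf hρ k i
  simpa [hi] using hC (ρ i) (hρ i)

/-- The Taylor coefficients at the origin, computed on the torus of radius `1/2`. -/
def taylorCoeff {n : ℕ} (f : (Fin n → ℂ) → ℂ) (k : Fin n → ℕ) : ℂ :=
  (∏ i, (2 : ℂ) ^ k i) * mFourierCoeff (fun t => f (torusPoint (fun _ => 1 / 2) t))
    (fun i => (k i : ℤ))

theorem coeff_eq {n : ℕ} {f : (Fin n → ℂ) → ℂ} (hf : DifferentiableOn ℂ f (polydisc n))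
    {ρ : Fin n → ℝ} (hρ : ∀ i, ρ i ∈ Ico (0 : ℝ) 1) (k : Fin n → ℕ) :
    mFourierCoeff (fun t => f (torusPoint ρ t)) (fun i => (k i : ℤ)) =
      (∏ i, (ρ i : ℂ) ^ k i) * taylorCoeff f k := by
  classical
  set G : (Fin n → ℝ) → ℂ := fun ρ =>
    mFourierCoeff (fun t => f (torusPoint ρ t)) (fun i => (k i : ℤ)) with hG
  set ρ0 : Fin n → ℝ := fun _ => 1 / 2 with hρ0
  have hρ0' : ∀ i, ρ0 i ∈ Ico (0 : ℝ) 1 := fun i => ⟨by norm_num [hρ0], by norm_num [hρ0]⟩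
  have key : ∀ S : Finset (Fin n), G (S.piecewise ρ ρ0) =
      (∏ i ∈ S, (ρ i : ℂ) ^ k i) * ((∏ i ∈ S, (2 : ℂ) ^ k i) * G ρ0) := by
    intro S
    induction S using Finset.induction_on with
    | empty => simp
    | insert j S hj ih =>
      have hS : ∀ i, S.piecewise ρ ρ0 i ∈ Ico (0 : ℝ) 1 := by
        intro i
        by_cases hi : i ∈ S
        · simpa [hi] using hρ i
        · simpa [hi] using hρ0' i
      obtain ⟨C, hC⟩ := exists_coeff_update hf hS (fun i => (k i : ℤ)) j
      have hC' : ∀ s ∈ Ico (0 : ℝ) 1, G (Function.update (S.piecewise ρ ρ0) j s) =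
          (s : ℂ) ^ k j * C := by
        intro s hs
        have h := hC s hs
        rw [if_neg (by simp)] at h
        simpa [hG] using h
      have e1 := hC' (ρ j) (hρ j)
      have e2 := hC' (ρ0 j) (hρ0' j)
      have e3 : Function.update (S.piecewise ρ ρ0) j (ρ0 j) = S.piecewise ρ ρ0 := by
        rw [Function.update_eq_self_iff]; simp [hj]
      rw [e3, ih] at e2
      rw [Finset.piecewise_insert, e1, Finset.prod_insert hj, Finset.prod_insert hj]
      have e4 : C = (2 : ℂ) ^ k j * ((∏ i ∈ S, (ρ i : ℂ) ^ k i) *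
          ((∏ i ∈ S, (2 : ℂ) ^ k i) * G ρ0)) := by
        rw [e2, ← mul_assoc, ← mul_pow]
        simp [hρ0]
      rw [e4]; ring
  have := key Finset.univ
  rw [Finset.piecewise_univ] at this
  exact this

theorem hasSum_sq_taylorCoeff {n : ℕ} {f : (Fin n → ℂ) → ℂ}
    (hf : DifferentiableOn ℂ f (polydisc n)) {ρ : Fin n → ℝ} (hρ : ∀ i, ρ i ∈ Ico (0 : ℝ) 1) :
    HasSum (fun k : Fin n → ℕ => (∏ i, ρ i ^ k i) ^ 2 * ‖taylorCoeff f k‖ ^ 2)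
      (∫ t, ‖f (torusPoint ρ t)‖ ^ 2 ∂(torusMeasure n)) := by
  have h := hasSum_sq_coeff (continuous_comp_torusPoint hf.continuousOn hρ)
  have hinj : Function.Injective fun (k : Fin n → ℕ) (i : Fin n) => (k i : ℤ) := by
    intro k l hkl
    funext i
    exact Nat.cast_injective (R := ℤ) (congrFun hkl i)
  rw [← hinj.hasSum_iff] at h
  · refine HasSum.congr_fun h fun k => ?_
    simp only [Function.comp]
    rw [coeff_eq hf hρ k, norm_mul, mul_pow, norm_prod]
    simp_rw [norm_pow, Complex.norm_real, Real.norm_eq_abs, abs_of_nonneg (hρ _).1]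
  · intro k hk
    rw [coeff_neg hf hρ]
    · simp
    · by_contra! h0
      exact hk ⟨fun i => (k i).toNat, by funext i; simp [h0 i]⟩

/-- `∫_{𝕋ⁿ} |f(rζ)|² dζ`. -/
def radialMean {n : ℕ} (f : (Fin n → ℂ) → ℂ) (r : ℝ) : ℝ :=
  ∫ t, ‖f (torusPoint (fun _ => r) t)‖ ^ 2 ∂(torusMeasure n)

theorem hasSum_radialMean {n : ℕ} {f : (Fin n → ℂ) → ℂ}
    (hf : DifferentiableOn ℂ f (polydisc n)) {r : ℝ} (hr : r ∈ Ico (0 : ℝ) 1) :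
    HasSum (fun k : Fin n → ℕ => (∏ i, r ^ k i) ^ 2 * ‖taylorCoeff f k‖ ^ 2) (radialMean f r) :=
  hasSum_sq_taylorCoeff hf fun _ => hr

theorem sum_sq_le_of_bound {n : ℕ} {f : (Fin n → ℂ) → ℂ}
    (hf : DifferentiableOn ℂ f (polydisc n)) {B : ℝ}
    (hB : ∀ r ∈ Ico (0 : ℝ) 1, radialMean f r ≤ B) (S : Finset (Fin n → ℕ)) :
    ∑ k ∈ S, ‖taylorCoeff f k‖ ^ 2 ≤ B := by
  have hcont : ContinuousAt (fun r : ℝ => ∑ k ∈ S, (∏ i, r ^ k i) ^ 2 * ‖taylorCoeff f k‖ ^ 2) 1 := by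
    fun_prop
  have hlim : Tendsto (fun r : ℝ => ∑ k ∈ S, (∏ i, r ^ k i) ^ 2 * ‖taylorCoeff f k‖ ^ 2)
      (𝓝[<] 1) (𝓝 (∑ k ∈ S, ‖taylorCoeff f k‖ ^ 2)) := by
    have := hcont.tendsto.mono_left (nhdsWithin_le_nhds (s := Iio (1 : ℝ)))
    simpa using this
  refine le_of_tendsto hlim ?_
  filter_upwards [Ico_mem_nhdsLT (show (0 : ℝ) < 1 by norm_num)] with r hr
  exact (sum_le_hasSum S (fun k _ => by positivity) (hasSum_radialMean hf hr)).trans (hB r hr)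

theorem radialMean_le_tsum {n : ℕ} {f : (Fin n → ℂ) → ℂ}
    (hf : DifferentiableOn ℂ f (polydisc n))
    (hs : Summable fun k => ‖taylorCoeff f k‖ ^ 2) {r : ℝ} (hr : r ∈ Ico (0 : ℝ) 1) :
    radialMean f r ≤ ∑' k, ‖taylorCoeff f k‖ ^ 2 := by
  refine hasSum_le (fun k => ?_) (hasSum_radialMean hf hr) hs.hasSum
  refine mul_le_of_le_one_left (by positivity) ?_
  refine pow_le_one₀ (Finset.prod_nonneg fun i _ => pow_nonneg hr.1 _) ?_
  exact Finset.prod_le_one (fun i _ => pow_nonneg hr.1 _) fun i _ => pow_le_one₀ hr.1 hr.2.le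

theorem bddAbove_iff {n : ℕ} {f : (Fin n → ℂ) → ℂ} (hf : DifferentiableOn ℂ f (polydisc n)) :
    BddAbove (radialMean f '' Ico (0 : ℝ) 1) ↔ Memℓp (taylorCoeff f) 2 := by
  rw [memℓp_gen_iff (by norm_num)]
  simp only [ENNReal.toReal_ofNat, Real.rpow_ofNat]
  constructor
  · rintro ⟨B, hB⟩
    refine summable_of_sum_le (fun k => by positivity) (c := B) ?_
    exact sum_sq_le_of_bound hf fun r hr => hB ⟨r, hr, rfl⟩
  · intro hs
    refine ⟨∑' k, ‖taylorCoeff f k‖ ^ 2, ?_⟩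
    rintro _ ⟨r, hr, rfl⟩
    exact radialMean_le_tsum hf hs hr

theorem iSup_radialMean {n : ℕ} {f : (Fin n → ℂ) → ℂ}
    (hf : DifferentiableOn ℂ f (polydisc n)) (hb : BddAbove (radialMean f '' Ico (0 : ℝ) 1)) :
    (⨆ r : Ico (0 : ℝ) 1, radialMean f r) = ∑' k, ‖taylorCoeff f k‖ ^ 2 := by
  have hs := (bddAbove_iff hf).1 hb
  rw [memℓp_gen_iff (by norm_num)] at hs
  simp only [ENNReal.toReal_ofNat, Real.rpow_ofNat] at hs
  have : Nonempty (Ico (0 : ℝ) 1) := ⟨⟨0, by simp⟩⟩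
  refine le_antisymm (ciSup_le fun r => radialMean_le_tsum hf hs r.2) ?_
  refine hs.tsum_le_of_sum_le (sum_sq_le_of_bound hf fun r hr => ?_)
  refine le_ciSup (f := fun r : Ico (0 : ℝ) 1 => radialMean f r) ?_ ⟨r, hr⟩
  refine hb.mono ?_
  rintro _ ⟨r, rfl⟩
  exact ⟨r, r.2, rfl⟩

theorem integrable_mul {n : ℕ} {g : UnitAddTorus (Fin n) → ℂ} (hg : Continuous g)
    (k : Fin n → ℤ) : Integrable (fun t => mFourier k t • g t) (torusMeasure n) := by
  refine Continuous.integrable_of_hasCompactSupport (by fun_prop) ?_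
  exact HasCompactSupport.of_compactSpace _

theorem half_mem : ∀ {n : ℕ} (_ : Fin n), (1 / 2 : ℝ) ∈ Ico (0 : ℝ) 1 :=
  fun _ => ⟨by norm_num, by norm_num⟩

theorem taylorCoeff_add {n : ℕ} {f g : (Fin n → ℂ) → ℂ} (hf : DifferentiableOn ℂ f (polydisc n))
    (hg : DifferentiableOn ℂ g (polydisc n)) :
    taylorCoeff (f + g) = taylorCoeff f + taylorCoeff g := by
  funext k
  simp only [taylorCoeff, mFourierCoeff_eq, Pi.add_apply, smul_add]
  rw [integral_add (integrable_mul (continuous_comp_torusPoint hf.continuousOn half_mem) _)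
    (integrable_mul (continuous_comp_torusPoint hg.continuousOn half_mem) _), mul_add]

theorem taylorCoeff_smul {n : ℕ} (c : ℂ) (f : (Fin n → ℂ) → ℂ) :
    taylorCoeff (c • f) = c • taylorCoeff f := by
  funext k
  simp only [taylorCoeff, mFourierCoeff_eq, Pi.smul_apply, smul_eq_mul]
  rw [mul_left_comm c, ← integral_const_mul c]
  congr 2
  funext t
  ring

theorem eq_zero_of_taylorCoeff {n : ℕ} {f : (Fin n → ℂ) → ℂ}
    (hf : DifferentiableOn ℂ f (polydisc n)) (h0 : taylorCoeff f = 0) {z : Fin n → ℂ}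
    (hz : z ∈ polydisc n) : f z = 0 := by
  have hρ : ∀ i, ‖z i‖ ∈ Ico (0 : ℝ) 1 := fun i => ⟨norm_nonneg _, hz i⟩
  have hc := continuous_comp_torusPoint hf.continuousOn hρ
  have h1 := hasSum_sq_taylorCoeff hf hρ
  simp only [h0, Pi.zero_apply, norm_zero, ne_eq, OfNat.ofNat_ne_zero, not_false_eq_true,
    zero_pow, mul_zero] at h1
  have h2 := h1.unique hasSum_zero
  have : (torusMeasure n).IsOpenPosMeasure := by unfold torusMeasure; infer_instance
  have hc2 : Continuous fun t => ‖f (torusPoint (fun i => ‖z i‖) t)‖ ^ 2 :=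
    hc.norm.pow 2
  have h3 := (integral_eq_zero_iff_of_nonneg (fun t => by positivity)
    (hc2.integrable_of_hasCompactSupport (HasCompactSupport.of_compactSpace _))).1 h2
  have h4 := (hc2.ae_eq_iff_eq _ continuous_zero).1 h3
  have h5 : ∀ w : ℂ, ∃ θ : UnitAddCircle, (‖w‖ : ℂ) * (AddCircle.toCircle θ : ℂ) = w := by
    intro w
    obtain ⟨θ, hθ⟩ := (AddCircle.homeomorphCircle (T := 1) one_ne_zero).surjective
      (Circle.exp w.arg)
    refine ⟨θ, ?_⟩
    have : AddCircle.toCircle θ = Circle.exp w.arg := by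
      rw [← hθ, AddCircle.homeomorphCircle_apply]
    rw [this, Circle.coe_exp, Complex.norm_mul_exp_arg_mul_I]
  choose θ hθ using h5
  have h6 := congrFun h4 fun i => θ (z i)
  have h7 : torusPoint (fun i => ‖z i‖) (fun i => θ (z i)) = z := by
    funext i
    exact hθ (z i)
  simpa [h7] using h6

theorem summable_prod_pow {r : ℝ} (hr : r ∈ Ico (0 : ℝ) 1) (n : ℕ) :
    Summable fun k : Fin n → ℕ => ∏ i, r ^ k i := by
  induction n with
  | zero => exact (hasSum_fintype _).summable
  | succ n ih =>
    rw [← (Fin.consEquiv fun _ => ℕ).summable_iff]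
    have := (summable_geometric_of_lt_one hr.1 hr.2).mul_of_nonneg ih
      (fun _ => pow_nonneg hr.1 _) (fun _ => Finset.prod_nonneg fun _ _ => pow_nonneg hr.1 _)
    refine this.congr fun x => ?_
    simp [Fin.consEquiv, Fin.prod_univ_succ]

theorem norm_monomial_le {n : ℕ} (k : Fin n → ℕ) {z : Fin n → ℂ} {r : ℝ}
    (hz : ∀ i, ‖z i‖ ≤ r) : ‖∏ i, z i ^ k i‖ ≤ ∏ i, r ^ k i := by
  rw [norm_prod]
  refine Finset.prod_le_prod (fun _ _ => norm_nonneg _) fun i _ => ?_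
  rw [norm_pow]
  exact pow_le_pow_left₀ (norm_nonneg _) (hz i) _

theorem summable_powerSeries {n : ℕ} {a : (Fin n → ℕ) → ℂ} {M : ℝ} (hM : ∀ k, ‖a k‖ ≤ M)
    {r : ℝ} (hr : r ∈ Ico (0 : ℝ) 1) {z : Fin n → ℂ} (hz : ∀ i, ‖z i‖ ≤ r) :
    Summable fun k => ‖a k * ∏ i, z i ^ k i‖ := by
  refine Summable.of_nonneg_of_le (fun _ => norm_nonneg _) (fun k => ?_)
    ((summable_prod_pow hr n).mul_left M)
  rw [norm_mul]
  exact mul_le_mul (hM k) (norm_monomial_le k hz) (norm_nonneg _) ((norm_nonneg _).trans (hM k))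

theorem differentiableOn_powerSeries {n : ℕ} {a : (Fin n → ℕ) → ℂ} {M : ℝ}
    (hM : ∀ k, ‖a k‖ ≤ M) :
    DifferentiableOn ℂ (fun z : Fin n → ℂ => ∑' k, a k * ∏ i, z i ^ k i) (polydisc n) := by
  rw [polydisc_eq_ball]
  intro z₀ hz₀
  obtain ⟨R, hR1, hR2⟩ := exists_between (mem_ball_zero_iff.1 hz₀)
  obtain ⟨R', hR3, hR4⟩ := exists_between hR2
  have hR0 : 0 < R := (norm_nonneg _).trans_lt hR1
  have hR' : R' ∈ Ico (0 : ℝ) 1 := ⟨by linarith, hR4⟩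
  have hd : ∀ k : Fin n → ℕ, Differentiable ℂ fun z : Fin n → ℂ => a k * ∏ i, z i ^ k i := by
    intro k; fun_prop
  have hbd : ∀ (k : Fin n → ℕ), ∀ z ∈ Metric.ball (0 : Fin n → ℂ) R',
      ‖a k * ∏ i, z i ^ k i‖ ≤ M * ∏ i, R' ^ k i := by
    intro k z hz
    rw [norm_mul]
    exact mul_le_mul (hM k) (norm_monomial_le k fun i =>
      (norm_le_pi_norm z i).trans (mem_ball_zero_iff.1 hz).le) (norm_nonneg _)
      ((norm_nonneg _).trans (hM k))
  refine (hasFDerivAt_tsum_of_isPreconnected (𝕜 := ℂ) (s := Metric.ball (0 : Fin n → ℂ) R)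
    (u := fun k => (2 * (M * ∏ i, R' ^ k i)) / (R' - R))
    (f := fun (k : Fin n → ℕ) (z : Fin n → ℂ) => a k * ∏ i, z i ^ k i)
    (f' := fun k z => fderiv ℂ (fun z : Fin n → ℂ => a k * ∏ i, z i ^ k i) z)
    (x₀ := 0) (x := z₀) ?_ Metric.isOpen_ball (convex_ball 0 R).isPreconnected
    (fun k z _ => (hd k z).hasFDerivAt) ?_ (Metric.mem_ball_self hR0) ?_
    (mem_ball_zero_iff.2 hR1)).differentiableAt.differentiableWithinAt
  · exact (((summable_prod_pow hR' n).mul_left M).mul_left 2).div_const _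
  · intro k z hz
    have hsub : Metric.ball z (R' - R) ⊆ Metric.ball 0 R' := by
      intro w hw
      rw [mem_ball_zero_iff] at hz ⊢
      rw [mem_ball_iff_norm] at hw
      have := norm_add_le (w - z) z
      rw [sub_add_cancel] at this
      linarith
    refine Complex.norm_fderiv_le_div_of_mapsTo_ball (hd k).differentiableOn ?_ (by linarith)
    intro w hw
    rw [Metric.mem_closedBall, dist_eq_norm]
    have h1 := hbd k w (hsub hw)
    have h2 := hbd k z (hsub (Metric.mem_ball_self (by linarith)))
    have := norm_sub_le (a k * ∏ i, w i ^ k i) (a k * ∏ i, z i ^ k i)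
    linarith
  · exact (summable_powerSeries hM hR' (z := 0) (by simpa using fun _ => hR'.1)).of_norm

theorem integral_mFourier_mul {n : ℕ} (k l : Fin n → ℤ) :
    ∫ t, mFourier (-k) t • mFourier l t ∂(torusMeasure n) = if k = l then 1 else 0 := by
  have h := orthonormal_iff_ite.1 (orthonormal_mFourier (d := Fin n)) k l
  rw [mFourierLp, mFourierLp, ContinuousMap.inner_toLp] at h
  rw [← h]
  refine integral_congr_ae (Eventually.of_forall fun t => ?_)
  simp [mFourier_neg, mul_comm]

theorem taylorCoeff_powerSeries {n : ℕ} {f : (Fin n → ℂ) → ℂ} {a : (Fin n → ℕ) → ℂ} {M : ℝ}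
    (hM : ∀ k, ‖a k‖ ≤ M) (hf : ∀ z ∈ polydisc n, f z = ∑' k, a k * ∏ i, z i ^ k i) :
    taylorCoeff f = a := by
  classical
  funext k
  have hz : ∀ (t : UnitAddTorus (Fin n)) i, ‖torusPoint (fun _ => 1 / 2) t i‖ ≤ 1 / 2 := by
    intro t i
    rw [norm_torusPoint, abs_of_nonneg (by norm_num)]
  have hmon : ∀ (t : UnitAddTorus (Fin n)) (l : Fin n → ℕ),
      ∏ i, torusPoint (fun _ => 1 / 2) t i ^ l i =
        (∏ i, (1 / 2 : ℂ) ^ l i) * mFourier (fun i => (l i : ℤ)) t := by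
    intro t l
    simp only [torusPoint, mul_pow, Finset.prod_mul_distrib, mFourier, ContinuousMap.coe_mk]
    congr 1
    · simp
    · refine Finset.prod_congr rfl fun i _ => ?_
      simp [fourier_apply, AddCircle.toCircle_nsmul]
  set F : (Fin n → ℕ) → UnitAddTorus (Fin n) → ℂ := fun l t =>
    mFourier (-(fun i => (k i : ℤ))) t • (a l * ∏ i, torusPoint (fun _ => 1 / 2) t i ^ l i) with hF
  have hFc : ∀ l, Continuous (F l) := by
    intro l
    have := continuous_torusPoint (n := n) fun _ => 1 / 2
    simp only [hF]
    fun_prop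
  have hFn : ∀ l t, ‖F l t‖ ≤ M * ∏ i, (1 / 2 : ℝ) ^ l i := by
    intro l t
    simp only [hF, norm_smul]
    have h1 : ‖mFourier (-(fun i => (k i : ℤ))) t‖ ≤ 1 :=
      (ContinuousMap.norm_coe_le_norm _ t).trans mFourier_norm.le
    have h2 : ‖a l * ∏ i, torusPoint (fun _ => 1 / 2) t i ^ l i‖ ≤ M * ∏ i, (1 / 2 : ℝ) ^ l i := by
      rw [norm_mul]
      exact mul_le_mul (hM l) (norm_monomial_le l (hz t)) (norm_nonneg _)
        ((norm_nonneg _).trans (hM l))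
    exact (mul_le_of_le_one_left (norm_nonneg _) h1).trans h2
  have hint : ∀ l, Integrable (F l) (torusMeasure n) := fun l =>
    (hFc l).integrable_of_hasCompactSupport (HasCompactSupport.of_compactSpace _)
  have hsum := hasSum_integral_of_summable_integral_norm hint (by
    refine Summable.of_nonneg_of_le (fun l => integral_nonneg fun t => norm_nonneg _) (fun l => ?_)
      ((summable_prod_pow (show (1 / 2 : ℝ) ∈ Ico (0 : ℝ) 1 by norm_num) n).mul_left M)
    refine (integral_mono (hint l).norm (integrable_const _) (hFn l)).trans ?_
    simp)
  have hterm : ∀ l, ∫ t, F l t ∂(torusMeasure n) =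
      if l = k then (∏ i, (1 / 2 : ℂ) ^ k i) * a k else 0 := by
    intro l
    have : ∀ t, F l t = (a l * ∏ i, (1 / 2 : ℂ) ^ l i) *
        (mFourier (-(fun i => (k i : ℤ))) t • mFourier (fun i => (l i : ℤ)) t) := by
      intro t
      simp only [hF, hmon, smul_eq_mul]; ring
    simp_rw [this]
    rw [integral_const_mul, integral_mFourier_mul]
    by_cases h : l = k
    · subst h; simp [mul_comm]
    · rw [if_neg, if_neg h, mul_zero]
      intro h'
      exact h (funext fun i => Nat.cast_injective (R := ℤ) (congrFun h' i).symm)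
  simp_rw [hterm] at hsum
  have h1 := hsum.unique (hasSum_ite_eq k _)
  have h2 : mFourierCoeff (fun t => f (torusPoint (fun _ => 1 / 2) t)) (fun i => (k i : ℤ)) =
      (∏ i, (1 / 2 : ℂ) ^ k i) * a k := by
    rw [← h1, mFourierCoeff_eq]
    refine integral_congr_ae (Eventually.of_forall fun t => ?_)
    have hs : Summable fun l => a l * ∏ i, torusPoint (fun _ => 1 / 2) t i ^ l i :=
      (summable_powerSeries hM (show (1 / 2 : ℝ) ∈ Ico (0 : ℝ) 1 by norm_num) (hz t)).of_norm
    simp only [hF]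
    rw [hf _ (torusPoint_mem half_mem t), hs.tsum_const_smul]
  rw [taylorCoeff, h2, ← mul_assoc, ← Finset.prod_mul_distrib]
  simp

/-- `f` is an element of the Hardy space `H²(𝔻ⁿ)`: holomorphic on `𝔻ⁿ`, with
`sup_{0 ≤ r < 1} ∫_{𝕋ⁿ} |f(rζ)|² dζ < ∞`. A function on `𝔻ⁿ` is represented by its extension by
zero to `ℂⁿ`, so that equality in `H²(𝔻ⁿ)` is equality on `𝔻ⁿ`. -/
structure MemH2 {n : ℕ} (f : (Fin n → ℂ) → ℂ) : Prop where
  differentiableOn : DifferentiableOn ℂ f (polydisc n)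
  eq_zero_off : ∀ z ∉ polydisc n, f z = 0
  bddAbove : BddAbove (radialMean f '' Ico (0 : ℝ) 1)

theorem MemH2.memℓp {n : ℕ} {f : (Fin n → ℂ) → ℂ} (hf : MemH2 f) : Memℓp (taylorCoeff f) 2 :=
  (bddAbove_iff hf.differentiableOn).1 hf.bddAbove

/-- The vector space of all functions in the Hardy space. -/
def H2Submodule (n : ℕ) : Submodule ℂ ((Fin n → ℂ) → ℂ) where
  carrier := {f | MemH2 f}
  zero_mem' := ⟨differentiableOn_const 0, fun _ _ => rfl,
    (bddAbove_iff (differentiableOn_const 0)).2 (by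
      have : taylorCoeff (0 : (Fin n → ℂ) → ℂ) = 0 := by
        simpa using taylorCoeff_smul 0 (0 : (Fin n → ℂ) → ℂ)
      change Memℓp (taylorCoeff (0 : (Fin n → ℂ) → ℂ)) 2
      rw [this]; exact zero_memℓp)⟩
  add_mem' {f g} hf hg := by
    have hd := hf.differentiableOn.add hg.differentiableOn
    refine ⟨hd, fun z hz => ?_, (bddAbove_iff hd).2 ?_⟩
    · simp [hf.eq_zero_off z hz, hg.eq_zero_off z hz]
    · rw [taylorCoeff_add hf.differentiableOn hg.differentiableOn]
      exact hf.memℓp.add hg.memℓp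
  smul_mem' c f hf := by
    have hd := hf.differentiableOn.const_smul c
    refine ⟨hd, fun z hz => ?_, (bddAbove_iff hd).2 ?_⟩
    · simp [hf.eq_zero_off z hz]
    · rw [taylorCoeff_smul]
      exact hf.memℓp.const_smul c

/-- The Hardy space `H²(𝔻ⁿ)`, a Hilbert space for the norm below; `H²(𝔻)` is `H2 1`. -/
def H2 (n : ℕ) : Type := H2Submodule n

namespace H2

variable {n : ℕ}

instance : AddCommGroup (H2 n) := inferInstanceAs (AddCommGroup (H2Submodule n))

instance : Module ℂ (H2 n) := inferInstanceAs (Module ℂ (H2Submodule n))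

instance : CoeFun (H2 n) fun _ => (Fin n → ℂ) → ℂ := ⟨fun f => f.1⟩

theorem mem (f : H2 n) : MemH2 (f : (Fin n → ℂ) → ℂ) := f.2

@[ext] theorem ext {f g : H2 n} (h : ∀ z ∈ polydisc n, f z = g z) : f = g := by
  refine Subtype.ext (funext fun z => ?_)
  by_cases hz : z ∈ polydisc n
  · exact h z hz
  · exact (f.mem.eq_zero_off z hz).trans (g.mem.eq_zero_off z hz).symm

theorem add_apply (f g : H2 n) (z : Fin n → ℂ) : (f + g) z = f z + g z := rfl

theorem smul_apply (c : ℂ) (f : H2 n) (z : Fin n → ℂ) : (c • f) z = c * f z := rfl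

/-- `‖f‖² = sup_{0 ≤ r < 1} ∫_{𝕋ⁿ} |f(rζ)|² dζ`. -/
instance : Norm (H2 n) := ⟨fun f => √(⨆ r : Ico (0 : ℝ) 1, radialMean f r)⟩

theorem norm_def (f : H2 n) : ‖f‖ = √(⨆ r : Ico (0 : ℝ) 1, radialMean f r) := rfl

/-- The Taylor coefficients of an element of `H²(𝔻ⁿ)`, as a square summable family. -/
def coeffs : H2 n →ₗ[ℂ] lp (fun _ : Fin n → ℕ => ℂ) 2 where
  toFun f := ⟨taylorCoeff f, f.mem.memℓp⟩
  map_add' f g := Subtype.ext (taylorCoeff_add f.mem.differentiableOn g.mem.differentiableOn)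
  map_smul' c f := Subtype.ext (taylorCoeff_smul c f)

theorem norm_coeffs (f : H2 n) : ‖coeffs f‖ = ‖f‖ := by
  rw [norm_def, iSup_radialMean f.mem.differentiableOn f.mem.bddAbove,
    lp.norm_eq_tsum_rpow (by norm_num), Real.sqrt_eq_rpow]
  simp [coeffs]

theorem coeffs_injective : Function.Injective (coeffs (n := n)) := by
  rw [← LinearMap.ker_eq_bot, LinearMap.ker_eq_bot']
  intro f hf
  refine H2.ext fun z hz => ?_
  exact eq_zero_of_taylorCoeff f.mem.differentiableOn (congrArg Subtype.val hf) hz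

theorem coeffs_surjective : Function.Surjective (coeffs (n := n)) := by
  classical
  intro a
  have hM : ∀ k, ‖a k‖ ≤ ‖a‖ := fun k => lp.norm_apply_le_norm (by norm_num) a k
  set f : (Fin n → ℂ) → ℂ := fun z =>
    if z ∈ polydisc n then ∑' k, a k * ∏ i, z i ^ k i else 0 with hf
  have hfe : ∀ z ∈ polydisc n, f z = ∑' k, a k * ∏ i, z i ^ k i := fun z hz => by
    simp [hf, hz]
  have hfd : DifferentiableOn ℂ f (polydisc n) := (differentiableOn_powerSeries hM).congr hfe
  have hfa : taylorCoeff f = a := taylorCoeff_powerSeries hM hfe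
  have hfm : MemH2 f := ⟨hfd, fun z hz => by simp [hf, hz], (bddAbove_iff hfd).2 (by
    rw [hfa]; exact lp.memℓp a)⟩
  exact ⟨⟨f, hfm⟩, Subtype.ext hfa⟩

theorem core (n : ℕ) : NormedSpace.Core ℂ (H2 n) where
  norm_nonneg f := by rw [← norm_coeffs]; exact norm_nonneg _
  norm_smul c f := by rw [← norm_coeffs, ← norm_coeffs, map_smul, norm_smul]
  norm_triangle f g := by
    rw [← norm_coeffs, ← norm_coeffs, ← norm_coeffs, map_add]; exact norm_add_le _ _
  norm_eq_zero_iff f := by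
    rw [← norm_coeffs, norm_eq_zero, ← map_zero (coeffs (n := n)), coeffs_injective.eq_iff]

instance : NormedAddCommGroup (H2 n) := NormedAddCommGroup.ofCore (core n)

/-- The inner product of `H²(𝔻ⁿ)`: the unique one inducing the norm. -/
instance : InnerProductSpace ℂ (H2 n) where
  norm_smul_le c f := ((core n).norm_smul c f).le
  inner f g := inner ℂ (coeffs f) (coeffs g)
  norm_sq_eq_re_inner f := by rw [← norm_coeffs]; exact norm_sq_eq_re_inner (𝕜 := ℂ) (coeffs f)
  conj_inner_symm f g := inner_conj_symm _ _
  add_left f g h := by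
    change inner ℂ (coeffs (f + g)) (coeffs h) = _
    rw [map_add, inner_add_left]
  smul_left f g c := by
    change inner ℂ (coeffs (c • f)) (coeffs g) = _
    rw [map_smul, inner_smul_left]

/-- `H²(𝔻ⁿ)` is isometrically isomorphic to `ℓ²(ℕⁿ)`. -/
def coeffsEquiv (n : ℕ) : H2 n ≃ₗᵢ[ℂ] lp (fun _ : Fin n → ℕ => ℂ) 2 where
  toLinearEquiv := LinearEquiv.ofBijective coeffs ⟨coeffs_injective, coeffs_surjective⟩
  norm_map' := norm_coeffs

instance : CompleteSpace (H2 n) :=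
  (completeSpace_congr (e := (coeffsEquiv n).toLinearEquiv.toEquiv)
    (coeffsEquiv n).isometry.isUniformEmbedding).2 inferInstance

theorem radialMean_coord_le (i : Fin n) (f : H2 n) {r : ℝ} (hr : r ∈ Ico (0 : ℝ) 1) :
    radialMean (fun z => z i * f z) r ≤ radialMean f r := by
  have hc : Continuous fun t => f (torusPoint (fun _ => r) t) :=
    continuous_comp_torusPoint f.mem.differentiableOn.continuousOn fun _ => hr
  have hp := (continuous_torusPoint (n := n) fun _ => r)
  refine integral_mono
    (Continuous.integrable_of_hasCompactSupport
      ((((continuous_apply i).comp hp).mul hc).norm.pow 2) (HasCompactSupport.of_compactSpace _))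
    (Continuous.integrable_of_hasCompactSupport (hc.norm.pow 2)
      (HasCompactSupport.of_compactSpace _))
    fun t => ?_
  have h1 : ‖torusPoint (fun _ => r) t i‖ ≤ 1 := (torusPoint_mem (fun _ => hr) t i).le
  have h2 : ‖torusPoint (fun _ => r) t i * f (torusPoint (fun _ => r) t)‖ ≤
      ‖f (torusPoint (fun _ => r) t)‖ := by
    rw [norm_mul]; exact mul_le_of_le_one_left (norm_nonneg _) h1
  exact pow_le_pow_left₀ (norm_nonneg _) h2 2

theorem memH2_coord_mul (i : Fin n) (f : H2 n) : MemH2 fun z => z i * f z where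
  differentiableOn := by
    have := f.mem.differentiableOn
    fun_prop
  eq_zero_off z hz := by rw [f.mem.eq_zero_off z hz, mul_zero]
  bddAbove := by
    obtain ⟨B, hB⟩ := f.mem.bddAbove
    refine ⟨B, ?_⟩
    rintro _ ⟨r, hr, rfl⟩
    exact (radialMean_coord_le i f hr).trans (hB ⟨r, hr, rfl⟩)

/-- The multiplication operator `M_{z_i}` on `H²(𝔻ⁿ)`. -/
def coordMul (i : Fin n) : H2 n →L[ℂ] H2 n :=
  LinearMap.mkContinuous
    { toFun := fun f => ⟨fun z => z i * f z, memH2_coord_mul i f⟩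
      map_add' := fun f g => Subtype.ext (funext fun z => mul_add (z i) (f z) (g z))
      map_smul' := fun c f => Subtype.ext (funext fun z => mul_left_comm (z i) c (f z)) } 1 (by
    intro f
    rw [one_mul, norm_def, norm_def]
    refine Real.sqrt_le_sqrt (ciSup_mono ?_ fun r => radialMean_coord_le i f r.2)
    refine f.mem.bddAbove.mono ?_
    rintro _ ⟨r, rfl⟩
    exact ⟨r, r.2, rfl⟩)

theorem coordMul_apply (i : Fin n) (f : H2 n) (z : Fin n → ℂ) : coordMul i f z = z i * f z := rfl

theorem integral_torus_one (g : UnitAddCircle → ℝ) :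
    ∫ t, g (t 0) ∂(torusMeasure 1) = ∫ θ, g θ ∂AddCircle.haarAddCircle :=
  (measurePreserving_funUnique (AddCircle.haarAddCircle (T := 1)) (Fin 1)).integral_comp
    (MeasurableEquiv.funUnique (Fin 1) UnitAddCircle).measurableEmbedding g

theorem memH2_tprod (f : Fin n → H2 1) :
    MemH2 ((polydisc n).indicator fun z => ∏ i, f i fun _ => z i) where
  differentiableOn := by
    refine DifferentiableOn.congr (f := fun z => ∏ i, f i fun _ => z i) ?_
      fun z hz => indicator_of_mem hz _
    intro z hz
    refine (HasFDerivWithinAt.finsetProd (u := Finset.univ)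
      (g := fun (i : Fin n) (z : Fin n → ℂ) => f i fun _ => z i)
      fun i _ => DifferentiableWithinAt.hasFDerivWithinAt ?_).differentiableWithinAt
    have h := (f i).mem.differentiableOn.comp (s := polydisc n)
      (f := fun z : Fin n → ℂ => fun _ : Fin 1 => z i) (by fun_prop) fun w hw _ => hw i
    exact h z hz
  eq_zero_off z hz := indicator_of_notMem hz _
  bddAbove := by
    have hrm : ∀ r ∈ Ico (0 : ℝ) 1,
        radialMean ((polydisc n).indicator fun z => ∏ i, f i fun _ => z i) r =
          ∏ i, radialMean (f i) r := by
      intro r hr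
      have h1 : ∀ i, radialMean (f i) r = ∫ θ : UnitAddCircle,
          ‖f i fun _ => (r : ℂ) * (AddCircle.toCircle θ : ℂ)‖ ^ 2 ∂AddCircle.haarAddCircle := by
        intro i
        rw [← integral_torus_one, radialMean]
        refine integral_congr_ae (Eventually.of_forall fun t => ?_)
        have : torusPoint (fun _ => r) t =
            fun _ => (r : ℂ) * (AddCircle.toCircle (t 0) : ℂ) := by
          funext j
          rw [Subsingleton.elim j 0]; rfl
        simp only [this]
      simp_rw [h1]
      rw [← integral_fintype_prod_eq_prod]
      refine integral_congr_ae (Eventually.of_forall fun t => ?_)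
      simp only [indicator_of_mem (torusPoint_mem (fun _ => hr) t), norm_prod, Finset.prod_pow]
      rfl
    choose B hB using fun i => (f i).mem.bddAbove
    refine ⟨∏ i, B i, ?_⟩
    rintro _ ⟨r, hr, rfl⟩
    rw [hrm r hr]
    exact Finset.prod_le_prod (fun i _ => integral_nonneg fun t => by positivity)
      fun i _ => hB i ⟨r, hr, rfl⟩

/-- The elementary tensor `f₁ ⊗ ⋯ ⊗ fₙ`, i.e. the function `z ↦ f₁(z₁) ⋯ fₙ(zₙ)`, under the
canonical identification of `H²(𝔻ⁿ)` with the Hilbert space tensor product of `n` copies of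
`H²(𝔻)`. -/
def tprod (f : Fin n → H2 1) : H2 n := ⟨_, memH2_tprod f⟩

theorem tprod_apply (f : Fin n → H2 1) {z : Fin n → ℂ} (hz : z ∈ polydisc n) :
    tprod f z = ∏ i, f i fun _ => z i :=
  indicator_of_mem (f := fun z : Fin n → ℂ => ∏ i, f i fun _ => z i) hz

end H2

variable {n : ℕ}

/-- A closed subspace invariant under all `M_{z_i}`. -/
def IsSubmodule (S : ClosedSubmodule ℂ (H2 n)) : Prop :=
  ∀ i, ∀ f ∈ S, H2.coordMul i f ∈ S

/-- A closed subspace whose orthogonal complement is a submodule. -/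
def IsQuotientModule (Q : ClosedSubmodule ℂ (H2 n)) : Prop := IsSubmodule Qᗮ

instance (Q : ClosedSubmodule ℂ (H2 n)) : CompleteSpace Q.toSubmodule :=
  Q.isClosed.completeSpace_coe

/-- The compression `C_{z_i} = P_Q M_{z_i}|_Q`. -/
def compression (Q : ClosedSubmodule ℂ (H2 n)) (i : Fin n) :
    Q.toSubmodule →L[ℂ] Q.toSubmodule :=
  Q.toSubmodule.orthogonalProjectionOnto ∘L H2.coordMul i ∘L Q.toSubmodule.subtypeL

/-- `C_{z_i} C_{z_j}^* = C_{z_j}^* C_{z_i}` for all `i < j`. -/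
def IsDoublyCommuting (Q : ClosedSubmodule ℂ (H2 n)) : Prop :=
  ∀ i j : Fin n, i < j →
    compression Q i ∘L (compression Q j).adjoint = (compression Q j).adjoint ∘L compression Q i

/-- The Hilbert space tensor product `Q₁ ⊗ ⋯ ⊗ Qₙ` as a closed subspace of `H²(𝔻ⁿ)`: the closed
linear span of the elementary tensors `f₁ ⊗ ⋯ ⊗ fₙ` with `fᵢ ∈ Qᵢ`. -/
def tensor (Q : Fin n → ClosedSubmodule ℂ (H2 1)) : ClosedSubmodule ℂ (H2 n) :=
  (Submodule.span ℂ {F | ∃ f : Fin n → H2 1, (∀ i, f i ∈ Q i) ∧ F = H2.tprod f}).closure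

/-- `Θ` is (on the open unit disc) an element of `H^∞(𝔻)`. -/
structure IsHInfty (Θ : ℂ → ℂ) : Prop where
  differentiableOn : DifferentiableOn ℂ Θ (Metric.ball 0 1)
  bounded : ∃ C : ℝ, ∀ z ∈ Metric.ball (0 : ℂ) 1, ‖Θ z‖ ≤ C

/-- `Θ` is inner: in `H^∞(𝔻)`, with radial limits of modulus one almost everywhere. -/
structure IsInner (Θ : ℂ → ℂ) : Prop extends IsHInfty Θ where
  boundary : ∀ᵐ θ : UnitAddCircle ∂AddCircle.haarAddCircle, ∃ w : ℂ, ‖w‖ = 1 ∧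
    Tendsto (fun r : ℝ => Θ ((r : ℂ) * (AddCircle.toCircle θ : ℂ))) (𝓝[<] 1) (𝓝 w)

/-- `Θ H²(𝔻)`. -/
def multRange (Θ : ℂ → ℂ) : Submodule ℂ (H2 1) where
  carrier := {g | ∃ f : H2 1, ∀ z ∈ polydisc 1, g z = Θ (z 0) * f z}
  zero_mem' := ⟨0, fun z _ => (mul_zero (Θ (z 0))).symm⟩
  add_mem' := by
    rintro g₁ g₂ ⟨f₁, h₁⟩ ⟨f₂, h₂⟩
    refine ⟨f₁ + f₂, fun z hz => ?_⟩
    rw [H2.add_apply, H2.add_apply, h₁ z hz, h₂ z hz, mul_add]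
  smul_mem' := by
    rintro c g ⟨f, h⟩
    refine ⟨c • f, fun z hz => ?_⟩
    rw [H2.smul_apply, H2.smul_apply, h z hz, mul_left_comm]

/-- `Q_Θ = H²(𝔻) ⊖ Θ H²(𝔻)`. -/
def modelSpace (Θ : ℂ → ℂ) : ClosedSubmodule ℂ (H2 1) :=
  ⟨(multRange Θ)ᗮ, (multRange Θ).isClosed_orthogonal⟩

end Hardy

end

/-!
# Doubly commuting quotient modules of the Hardy space of the polydisc

Write `S` for the shift on `H²(𝔻)`, `Mᵢ` for multiplication by `zᵢ`, and `P` for the projection onto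
a closed subspace `Q`. Everything is checked on elementary tensors, which span a dense subspace; an
operator acting on the `i`-th tensor factor only is described by `IsSlot`, and
`⟨f₁ ⊗ ⋯ ⊗ fₙ, g₁ ⊗ ⋯ ⊗ gₙ⟩ = ∏ ⟨fᵢ, gᵢ⟩` (`H2.inner_tprod`) gives the formula
`P_{R₁ ⊗ ⋯ ⊗ Rₙ} = P_{R₁} ⊗ ⋯ ⊗ P_{Rₙ}` (`proj_tensor_tprod`).

*Tensor products are doubly commuting.* If every `Rᵢ` is invariant under `S*`, the formula for the
projection shows that `R₁ ⊗ ⋯ ⊗ Rₙ` is a quotient module and that its compressions doubly commute.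

*Doubly commuting quotient modules are tensor products* (`eq_tensor_sliceSpace`). Let `Qᵢ` be the
closed span of all one-variable slices in `zᵢ` of elements of `Q`. It is `S*`-invariant, and `Q` is
contained in the cylinder `Lᵢ` over `Qᵢ`, hence in `⋂ Lᵢ = Q₁ ⊗ ⋯ ⊗ Qₙ`. For the converse inclusion,
double commutation is equivalent to `Mⱼ* (1 - P) Mᵢ f = (1 - P) Mᵢ Mⱼ* f` for `f ∈ Q` and `i ≠ j`.
It follows that `(1 - P) Mᵢ f` is orthogonal to all translates of `Q` in the variables other than
`zᵢ`, and therefore to `Lᵢ` (`proj_cylinder_eq_zero`). So `P_{Lᵢ} Mᵢ` maps `Q`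
into itself, and `Q` is invariant under the rank-one operators `|P_{Qᵢ} z^b⟩⟨z^a|` acting on the
`i`-th factor. The products of these over all `i` send an element of `Q` with nonzero coefficient at
`z^a` to nonzero multiples of the vectors `P_{Q₁} z^{b₁} ⊗ ⋯ ⊗ P_{Qₙ} z^{bₙ}`, which span a dense
subspace of `Q₁ ⊗ ⋯ ⊗ Qₙ`.

*One variable* (`exists_eq_modelSpace`). Beurling's theorem identifies the `S*`-invariant subspaces
of `H²(𝔻)` with the spaces `Q_Θ`. A unit wandering vector `θ` of the orthogonal complement has a
unimodular boundary value, since the Fourier coefficients of its modulus squared are known; it is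
bounded, being the Poisson integral of its boundary value, and its multiples `z^k θ` span a dense
subspace of that complement. The definition of an inner function also asks for radial limits; these
are provided by Fatou's theorem (`ae_tendsto_radial`), proved at the Lebesgue points of the boundary
value by a dyadic estimate of the Poisson kernel.
-/

noncomputable section

namespace Hardy

/-! ### Monomials and elementary tensors -/

/-- A product of `n` absolutely convergent series, expanded as a series indexed by `ℕⁿ`. -/
theorem hasSum_prod_pi {n : ℕ} {a : Fin n → ℕ → ℂ} (ha : ∀ i, Summable fun m => ‖a i m‖) :
    (Summable fun k : Fin n → ℕ => ‖∏ i, a i (k i)‖) ∧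
      HasSum (fun k : Fin n → ℕ => ∏ i, a i (k i)) (∏ i, ∑' m, a i m) := by
  induction n with
  | zero => exact ⟨(hasSum_fintype _).summable, by simp⟩
  | succ n ih =>
    obtain ⟨h1, h2⟩ := ih fun i => ha i.succ
    have h3 := Summable.mul_norm (ha 0) h1
    have h4 : HasSum (fun x : ℕ × (Fin n → ℕ) => a 0 x.1 * ∏ i, a i.succ (x.2 i))
        ((∑' m, a 0 m) * ∏ i : Fin n, ∑' m, a i.succ m) := by
      rw [← h2.tsum_eq, tsum_mul_tsum_of_summable_norm (ha 0) h1]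
      exact h3.of_norm.hasSum
    constructor
    · rw [← (Fin.consEquiv fun _ => ℕ).summable_iff]
      refine h3.congr fun x => ?_
      simp [Fin.consEquiv, Fin.prod_univ_succ]
    · rw [← (Fin.consEquiv fun _ => ℕ).hasSum_iff, Fin.prod_univ_succ]
      refine h4.congr_fun fun x => ?_
      simp [Fin.consEquiv, Fin.prod_univ_succ]

namespace H2

variable {n : ℕ}

theorem norm_taylorCoeff_le (f : H2 n) (k : Fin n → ℕ) : ‖taylorCoeff f k‖ ≤ ‖f‖ := by
  rw [← norm_coeffs]
  exact lp.norm_apply_le_norm (by norm_num) (coeffs f) k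

theorem summable_taylor (f : H2 n) {z : Fin n → ℂ} (hz : z ∈ polydisc n) :
    Summable fun k => ‖taylorCoeff f k * ∏ i, z i ^ k i‖ := by
  have h1 : ‖z‖ < 1 := by rwa [polydisc_eq_ball, mem_ball_zero_iff] at hz
  exact summable_powerSeries (norm_taylorCoeff_le f) ⟨norm_nonneg z, h1⟩ (norm_le_pi_norm z)

theorem hasSum_taylor (f : H2 n) {z : Fin n → ℂ} (hz : z ∈ polydisc n) :
    HasSum (fun k => taylorCoeff f k * ∏ i, z i ^ k i) (f z) := by
  have hM := norm_taylorCoeff_le f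
  set F : (Fin n → ℂ) → ℂ := fun z => ∑' k, taylorCoeff f k * ∏ i, z i ^ k i with hF
  have hFd : DifferentiableOn ℂ F (polydisc n) := differentiableOn_powerSeries hM
  have h0 : taylorCoeff (f.1 + (-1 : ℂ) • F) = 0 := by
    rw [taylorCoeff_add f.mem.differentiableOn (hFd.const_smul _), taylorCoeff_smul,
      taylorCoeff_powerSeries (f := F) hM fun z _ => rfl]
    simp
  have h1 := eq_zero_of_taylorCoeff (f.mem.differentiableOn.add (hFd.const_smul (-1 : ℂ))) h0 hz
  have h2 : f z = F z := by
    have : f z + -1 * F z = 0 := h1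
    linear_combination this
  rw [h2]
  exact (summable_taylor f hz).of_norm.hasSum

/-- The monomial `z ↦ z₁^{k₁} ⋯ zₙ^{kₙ}`, defined through its Taylor coefficients. -/
def monomial (k : Fin n → ℕ) : H2 n := (coeffsEquiv n).symm (lp.single 2 k 1)

theorem coeffs_monomial (k : Fin n → ℕ) : coeffs (monomial k) = lp.single 2 k 1 :=
  (coeffsEquiv n).apply_symm_apply _

theorem taylorCoeff_monomial (k l : Fin n → ℕ) :
    taylorCoeff (monomial k) l = if l = k then 1 else 0 := by
  have h := congrArg (fun a : lp (fun _ : Fin n → ℕ => ℂ) 2 => a l) (coeffs_monomial k)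
  simp only [lp.single_apply, Pi.single_apply] at h
  exact h

theorem monomial_apply (k : Fin n → ℕ) {z : Fin n → ℂ} (hz : z ∈ polydisc n) :
    monomial k z = ∏ i, z i ^ k i := by
  refine (hasSum_taylor (monomial k) hz).unique ?_
  have h := hasSum_single (f := fun l => taylorCoeff (monomial k) l * ∏ i, z i ^ l i) k
    fun l hl => by rw [taylorCoeff_monomial, if_neg hl, zero_mul]
  rwa [taylorCoeff_monomial, if_pos rfl, one_mul] at h

theorem inner_monomial (k : Fin n → ℕ) (f : H2 n) :
    inner ℂ (monomial k) f = taylorCoeff f k := by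
  change inner ℂ (coeffs (monomial k)) (coeffs f) = _
  rw [coeffs_monomial]
  refine (lp.inner_single_left (𝕜 := ℂ) (G := fun _ : Fin n → ℕ => ℂ) k 1 (coeffs f)).trans ?_
  simp [coeffs]

theorem ext_inner_monomial {f g : H2 n}
    (h : ∀ k, inner ℂ (monomial k) f = inner ℂ (monomial k) g) : f = g := by
  refine coeffs_injective (Subtype.ext (funext fun k => ?_))
  have := h k
  rwa [inner_monomial, inner_monomial] at this

theorem dense_span_monomial :
    Dense (Submodule.span ℂ (range (monomial (n := n))) : Set (H2 n)) := by
  rw [Submodule.dense_iff_topologicalClosure_eq_top, Submodule.topologicalClosure_eq_top_iff,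
    Submodule.eq_bot_iff]
  intro f hf
  refine ext_inner_monomial fun k => ?_
  rw [inner_zero_right]
  exact hf _ (Submodule.subset_span ⟨k, rfl⟩)

/-- Operators agreeing on the monomials are equal. -/
theorem clm_ext_monomial {E : Type*} [NormedAddCommGroup E] [NormedSpace ℂ E]
    {A B : H2 n →L[ℂ] E} (h : ∀ k, A (monomial k) = B (monomial k)) : A = B :=
  ContinuousLinearMap.ext_on dense_span_monomial (by rintro _ ⟨k, rfl⟩; exact h k)

theorem coordMul_monomial (i : Fin n) (k : Fin n → ℕ) :
    coordMul i (monomial k) = monomial (Function.update k i (k i + 1)) := by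
  refine H2.ext fun z hz => ?_
  rw [coordMul_apply, monomial_apply _ hz, monomial_apply _ hz,
    ← Finset.mul_prod_erase _ _ (Finset.mem_univ i),
    ← Finset.mul_prod_erase _ (fun j => z j ^ _) (Finset.mem_univ i), Function.update_self, pow_succ',
    mul_assoc]
  congr 2
  exact Finset.prod_congr rfl fun j hj => by rw [Function.update_of_ne (Finset.ne_of_mem_erase hj)]

/-- The monomial `z ↦ zᵐ` in `H²(𝔻)`. -/
def zPow (m : ℕ) : H2 1 := monomial fun _ => m

theorem monomial_one (k : Fin 1 → ℕ) : monomial k = zPow (k 0) :=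
  congrArg monomial (funext fun i => congrArg k (Subsingleton.elim i 0))

theorem tprod_zPow (k : Fin n → ℕ) : tprod (fun i => zPow (k i)) = monomial k := by
  refine H2.ext fun z hz => ?_
  rw [tprod_apply _ hz, monomial_apply _ hz]
  refine Finset.prod_congr rfl fun i _ => ?_
  rw [zPow, monomial_apply _ fun _ => hz i]
  simp

theorem funUnique_symm_apply (m : ℕ) :
    (Equiv.funUnique (Fin 1) ℕ).symm m = fun _ => m :=
  (Equiv.symm_apply_eq _).2 rfl

theorem taylorCoeff_tprod (f : Fin n → H2 1) (k : Fin n → ℕ) :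
    taylorCoeff (tprod f) k = ∏ i, taylorCoeff (f i) (fun _ => k i) := by
  have hM : ∀ k : Fin n → ℕ, ‖∏ i, taylorCoeff (f i) (fun _ => k i)‖ ≤ ∏ i, ‖f i‖ := by
    intro k
    rw [norm_prod]
    exact Finset.prod_le_prod (fun _ _ => norm_nonneg _) fun i _ => norm_taylorCoeff_le _ _
  refine congrFun (taylorCoeff_powerSeries (f := tprod f) hM fun z hz => ?_) k
  have h1 : ∀ i, (fun k : Fin 1 → ℕ => taylorCoeff (f i) k * ∏ j, z i ^ k j) ∘
      (Equiv.funUnique (Fin 1) ℕ).symm = fun m => taylorCoeff (f i) (fun _ => m) * z i ^ m := by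
    intro i
    funext m
    rw [Function.comp_apply, funUnique_symm_apply, Fin.prod_univ_one]
  have h2 : ∀ i, HasSum (fun m => taylorCoeff (f i) (fun _ => m) * z i ^ m) (f i fun _ => z i) := by
    intro i
    rw [← h1, Equiv.hasSum_iff]
    exact hasSum_taylor (f i) (z := fun _ => z i) fun _ => hz i
  have h3 : ∀ i, Summable fun m => ‖taylorCoeff (f i) (fun _ => m) * z i ^ m‖ :=
    fun i => (h2 i).summable.norm
  rw [tprod_apply _ hz]
  simp_rw [← (h2 _).tsum_eq, ← Finset.prod_mul_distrib]
  have := (hasSum_prod_pi h3).2.tsum_eq.symm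
  simpa only [Finset.prod_mul_distrib] using this

theorem hasSum_inner_one (f g : H2 1) : HasSum (fun m : ℕ =>
    taylorCoeff g (fun _ => m) * starRingEnd ℂ (taylorCoeff f (fun _ => m))) (inner ℂ f g) := by
  have h := lp.hasSum_inner (𝕜 := ℂ) (coeffs f) (coeffs g)
  rw [← (Equiv.funUnique (Fin 1) ℕ).symm.hasSum_iff] at h
  exact h

theorem inner_tprod (f g : Fin n → H2 1) :
    inner ℂ (tprod f) (tprod g) = ∏ i, inner ℂ (f i) (g i) := by
  have h1 := lp.hasSum_inner (𝕜 := ℂ) (coeffs (tprod f)) (coeffs (tprod g))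
  refine h1.unique ?_
  have h2 := (hasSum_prod_pi (n := n) fun i => (hasSum_inner_one (f i) (g i)).summable.norm).2
  simp_rw [(hasSum_inner_one _ _).tsum_eq] at h2
  refine h2.congr_fun fun k => ?_
  change taylorCoeff (tprod g) k * starRingEnd ℂ (taylorCoeff (tprod f) k) = _
  rw [taylorCoeff_tprod, taylorCoeff_tprod, map_prod, Finset.prod_mul_distrib]

theorem norm_tprod (f : Fin n → H2 1) : ‖tprod f‖ = ∏ i, ‖f i‖ := by
  have h : (‖tprod f‖ : ℂ) ^ 2 = (∏ i, (‖f i‖ : ℂ)) ^ 2 := by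
    rw [← Finset.prod_pow]
    refine (inner_self_eq_norm_sq_to_K (𝕜 := ℂ) (tprod f)).symm.trans ((inner_tprod f f).trans ?_)
    exact Finset.prod_congr rfl fun i _ => inner_self_eq_norm_sq_to_K (𝕜 := ℂ) (f i)
  have h' : ‖tprod f‖ ^ 2 = (∏ i, ‖f i‖) ^ 2 := by exact_mod_cast h
  exact (pow_left_inj₀ (norm_nonneg _) (Finset.prod_nonneg fun i _ => norm_nonneg _)
    two_ne_zero).1 h'

/-- Operators agreeing on the elementary tensors are equal. -/
theorem clm_ext_tprod {E : Type*} [NormedAddCommGroup E] [NormedSpace ℂ E]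
    {A B : H2 n →L[ℂ] E} (h : ∀ g, A (tprod g) = B (tprod g)) : A = B :=
  clm_ext_monomial fun k => by rw [← tprod_zPow]; exact h _

theorem ext_inner_tprod {f g : H2 n}
    (h : ∀ u, inner ℂ (tprod u) f = inner ℂ (tprod u) g) : f = g :=
  ext_inner_monomial fun k => by rw [← tprod_zPow]; exact h _

theorem tprod_update_apply (g : Fin n → H2 1) (i : Fin n) (x : H2 1) {z : Fin n → ℂ}
    (hz : z ∈ polydisc n) : tprod (Function.update g i x) z =
      x (fun _ => z i) * ∏ j ∈ Finset.univ.erase i, g j (fun _ => z j) := by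
  rw [tprod_apply _ hz, ← Finset.mul_prod_erase _ _ (Finset.mem_univ i), Function.update_self]
  congr 1
  exact Finset.prod_congr rfl fun j hj => by rw [Function.update_of_ne (Finset.ne_of_mem_erase hj)]

theorem tprod_update_smul (g : Fin n → H2 1) (i : Fin n) (c : ℂ) (x : H2 1) :
    tprod (Function.update g i (c • x)) = c • tprod (Function.update g i x) := by
  refine H2.ext fun z hz => ?_
  rw [H2.smul_apply, tprod_update_apply _ _ _ hz, tprod_update_apply _ _ _ hz, H2.smul_apply,
    mul_assoc]

theorem tprod_update_add (g : Fin n → H2 1) (i : Fin n) (x y : H2 1) :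
    tprod (Function.update g i (x + y)) =
      tprod (Function.update g i x) + tprod (Function.update g i y) := by
  refine H2.ext fun z hz => ?_
  rw [H2.add_apply, tprod_update_apply _ _ _ hz, tprod_update_apply _ _ _ hz,
    tprod_update_apply _ _ _ hz, H2.add_apply, add_mul]

theorem tprod_update_sub (g : Fin n → H2 1) (i : Fin n) (x y : H2 1) :
    tprod (Function.update g i (x - y)) =
      tprod (Function.update g i x) - tprod (Function.update g i y) := by
  rw [eq_sub_iff_add_eq, ← tprod_update_add, sub_add_cancel]

theorem inner_tprod_update (f g : Fin n → H2 1) (i : Fin n) (x y : H2 1) :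
    inner ℂ (tprod (Function.update f i x)) (tprod (Function.update g i y)) =
      inner ℂ x y * ∏ j ∈ Finset.univ.erase i, inner ℂ (f j) (g j) := by
  rw [inner_tprod, ← Finset.mul_prod_erase _ _ (Finset.mem_univ i), Function.update_self,
    Function.update_self]
  congr 1
  exact Finset.prod_congr rfl fun j hj => by
    rw [Function.update_of_ne (Finset.ne_of_mem_erase hj),
      Function.update_of_ne (Finset.ne_of_mem_erase hj)]

/-- The map `x ↦ g₁ ⊗ ⋯ ⊗ x ⊗ ⋯ ⊗ gₙ`, with `x` in position `i`. -/
def insertAt (g : Fin n → H2 1) (i : Fin n) : H2 1 →L[ℂ] H2 n :=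
  LinearMap.mkContinuous
    { toFun := fun x => tprod (Function.update g i x)
      map_add' := tprod_update_add g i
      map_smul' := tprod_update_smul g i } (∏ j ∈ Finset.univ.erase i, ‖g j‖) (by
    intro x
    rw [LinearMap.coe_mk, AddHom.coe_mk, norm_tprod,
      ← Finset.mul_prod_erase _ _ (Finset.mem_univ i), Function.update_self, mul_comm]
    refine le_of_eq (congrArg (· * ‖x‖) ?_)
    exact Finset.prod_congr rfl fun j hj => by
      rw [Function.update_of_ne (Finset.ne_of_mem_erase hj)])

theorem insertAt_apply (g : Fin n → H2 1) (i : Fin n) (x : H2 1) :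
    insertAt g i x = tprod (Function.update g i x) := rfl

theorem adjoint_insertAt_tprod (g h : Fin n → H2 1) (i : Fin n) :
    (insertAt g i).adjoint (tprod h) =
      (∏ j ∈ Finset.univ.erase i, inner ℂ (g j) (h j)) • h i := by
  refine ext_inner_left ℂ fun x => ?_
  rw [ContinuousLinearMap.adjoint_inner_right, insertAt_apply, inner_smul_right, mul_comm,
    ← inner_tprod_update, Function.update_eq_self]

end H2

open H2

variable {n : ℕ}

/-! ### Operators acting on one tensor factor -/

/-- `B` is the operator `1 ⊗ ⋯ ⊗ A ⊗ ⋯ ⊗ 1` on `H²(𝔻ⁿ)`, with `A` acting on the `i`-th factor. -/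
def IsSlot (i : Fin n) (A : H2 1 →L[ℂ] H2 1) (B : H2 n →L[ℂ] H2 n) : Prop :=
  ∀ g : Fin n → H2 1, B (tprod g) = tprod (Function.update g i (A (g i)))

namespace IsSlot

variable {i j : Fin n} {A A' : H2 1 →L[ℂ] H2 1} {B B' : H2 n →L[ℂ] H2 n}

theorem one (i : Fin n) : IsSlot i 1 1 := fun g => by simp

theorem mul (h : IsSlot i A B) (h' : IsSlot i A' B') : IsSlot i (A * A') (B * B') := fun g => by
  rw [mul_apply_eq_comp, h' g, h, Function.update_idem, Function.update_self]
  rfl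

theorem sub (h : IsSlot i A B) (h' : IsSlot i A' B') : IsSlot i (A - A') (B - B') := fun g => by
  rw [_root_.sub_apply, h g, h' g, ← tprod_update_sub]
  rfl

theorem pow (h : IsSlot i A B) (m : ℕ) : IsSlot i (A ^ m) (B ^ m) := by
  induction m with
  | zero => exact one i
  | succ m ih => rw [pow_succ, pow_succ]; exact ih.mul h

theorem adjoint (h : IsSlot i A B) : IsSlot i A.adjoint B.adjoint := fun g => by
  refine ext_inner_tprod fun u => ?_
  have h1 := inner_tprod_update u g i (A (u i)) (g i)
  have h2 := inner_tprod_update u g i (u i) (A.adjoint (g i))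
  rw [Function.update_eq_self] at h1 h2
  rw [ContinuousLinearMap.adjoint_inner_right, h u, h1, h2,
    ContinuousLinearMap.adjoint_inner_right]

theorem commute (hij : i ≠ j) (h : IsSlot i A B) (h' : IsSlot j A' B') : Commute B B' := by
  refine clm_ext_tprod fun g => ?_
  rw [mul_apply_eq_comp, mul_apply_eq_comp, h' g, h, h g,
    h', Function.update_of_ne hij, Function.update_of_ne hij.symm, Function.update_comm hij]

end IsSlot

/-- The unilateral shift on `H²(𝔻)`. -/
abbrev shift : H2 1 →L[ℂ] H2 1 := coordMul 0

theorem isSlot_coordMul (i : Fin n) : IsSlot i shift (coordMul i) := fun g => by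
  refine H2.ext fun z hz => ?_
  rw [coordMul_apply, tprod_update_apply _ _ _ hz, coordMul_apply, tprod_apply _ hz,
    ← Finset.mul_prod_erase _ _ (Finset.mem_univ i), mul_assoc]

theorem shift_zPow (m : ℕ) : shift (zPow m) = zPow (m + 1) := by
  rw [zPow, coordMul_monomial, monomial_one, Function.update_self]

theorem shift_pow_zPow (m l : ℕ) : (shift ^ m) (zPow l) = zPow (l + m) := by
  induction m generalizing l with
  | zero => rfl
  | succ m ih =>
    rw [pow_succ, mul_apply_eq_comp, shift_zPow, ih, add_right_comm, add_assoc]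

theorem inner_zPow (m l : ℕ) : inner ℂ (zPow m) (zPow l) = if m = l then (1 : ℂ) else 0 := by
  rw [zPow, zPow, inner_monomial, taylorCoeff_monomial]
  simp [funext_iff]

theorem ext_inner_zPow {f g : H2 1} (h : ∀ m, inner ℂ (zPow m) f = inner ℂ (zPow m) g) : f = g :=
  ext_inner_monomial fun k => by rw [monomial_one]; exact h _

theorem clm_ext_zPow {E : Type*} [NormedAddCommGroup E] [NormedSpace ℂ E]
    {A B : H2 1 →L[ℂ] E} (h : ∀ m, A (zPow m) = B (zPow m)) : A = B :=
  clm_ext_monomial fun k => by rw [monomial_one]; exact h _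

theorem adjoint_shift_mul_shift : shift.adjoint * shift = 1 := by
  refine clm_ext_zPow fun m => ext_inner_zPow fun l => ?_
  rw [mul_apply_eq_comp, ContinuousLinearMap.adjoint_inner_right, shift_zPow,
    shift_zPow, inner_zPow, one_apply_eq_self, inner_zPow]
  simp

theorem adjoint_coordMul_coordMul (i : Fin n) (f : H2 n) :
    (coordMul i).adjoint (coordMul i f) = f := by
  have h : (coordMul i).adjoint * coordMul i = 1 := clm_ext_tprod fun g => by
    rw [(isSlot_coordMul i).adjoint.mul (isSlot_coordMul i) g, adjoint_shift_mul_shift]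
    simp
  exact congrArg (fun A : H2 n →L[ℂ] H2 n => A f) h

theorem adjoint_coordMul_comm {i j : Fin n} (hij : i ≠ j) (f : H2 n) :
    (coordMul i).adjoint (coordMul j f) = coordMul j ((coordMul i).adjoint f) :=
  congrArg (fun A : H2 n →L[ℂ] H2 n => A f)
    ((isSlot_coordMul i).adjoint.commute hij (isSlot_coordMul j)).eq

/-- `1 - S S*` is the projection onto the constants. -/
theorem one_sub_shift_mul_adjoint (x : H2 1) :
    x - shift (shift.adjoint x) = inner ℂ (zPow 0) x • zPow 0 := by
  have h : 1 - shift * shift.adjoint = (innerSL ℂ (zPow 0)).smulRight (zPow 0) := by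
    refine clm_ext_zPow fun m => ?_
    rw [ContinuousLinearMap.smulRight_apply, innerSL_apply_apply, inner_zPow,
      _root_.sub_apply, mul_apply_eq_comp,
      one_apply_eq_self]
    cases m with
    | zero =>
      have : shift.adjoint (zPow 0) = 0 := ext_inner_zPow fun l => by
        rw [ContinuousLinearMap.adjoint_inner_right, shift_zPow, inner_zPow, inner_zero_right,
          if_neg (by omega)]
      simp [this]
    | succ m =>
      have : shift.adjoint (shift (zPow m)) = zPow m := adjoint_coordMul_coordMul 0 _
      rw [← shift_zPow, this, if_neg (by omega), zero_smul, sub_self]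
  exact congrArg (fun A : H2 1 →L[ℂ] H2 1 => A x) h

theorem inner_adjoint_shift_pow (a : ℕ) (x : H2 1) :
    inner ℂ (zPow 0) ((shift.adjoint ^ a) x) = inner ℂ (zPow a) x := by
  have : shift.adjoint ^ a = (shift ^ a).adjoint := (star_pow shift a).symm
  rw [this, ContinuousLinearMap.adjoint_inner_right, shift_pow_zPow, zero_add]

/-- Rank-one operators on distinct factors multiply to an operator that inherits every subspace
invariant under all of them. -/
theorem exists_prod_rankOne {V : Submodule ℂ (H2 n)} (x y : Fin n → H2 1) (s : Finset (Fin n))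
    (hs : ∀ j ∈ s, ∃ (A : H2 1 →L[ℂ] H2 1) (B : H2 n →L[ℂ] H2 n), IsSlot j A B ∧
      (∀ u, A u = inner ℂ (y j) u • x j) ∧ ∀ f ∈ V, B f ∈ V) :
    ∃ B : H2 n →L[ℂ] H2 n, (∀ f ∈ V, B f ∈ V) ∧
      ∀ h, B (tprod h) = (∏ j ∈ s, inner ℂ (y j) (h j)) • tprod (s.piecewise x h) := by
  induction s using Finset.induction_on with
  | empty => exact ⟨1, fun f hf => hf, fun h => by simp⟩
  | insert j s hj ih =>
    obtain ⟨B, hBV, hB⟩ := ih fun l hl => hs l (Finset.mem_insert_of_mem hl)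
    obtain ⟨A, C, hC, hA, hCV⟩ := hs j (Finset.mem_insert_self j s)
    refine ⟨C * B, fun f hf => hCV _ (hBV f hf), fun h => ?_⟩
    rw [mul_apply_eq_comp, hB, map_smul, hC, hA, tprod_update_smul, smul_smul,
      Finset.prod_insert hj, Finset.piecewise_insert, Finset.piecewise_eq_of_notMem _ _ _ hj,
      mul_comm]

/-! ### Projections onto tensor products -/

/-- The orthogonal projection onto a closed subspace. -/
abbrev proj {m : ℕ} (R : ClosedSubmodule ℂ (H2 m)) : H2 m →L[ℂ] H2 m := R.toSubmodule.starProjection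

section proj

variable {m : ℕ} (R : ClosedSubmodule ℂ (H2 m))

theorem proj_mem (x : H2 m) : proj R x ∈ R := R.toSubmodule.starProjection_apply_mem x

theorem proj_eq_self {x : H2 m} (hx : x ∈ R) : proj R x = x :=
  Submodule.starProjection_eq_self_iff.2 hx

theorem mem_of_proj_eq {x : H2 m} (hx : proj R x = x) : x ∈ R :=
  Submodule.starProjection_eq_self_iff.1 hx

theorem inner_proj_left (x y : H2 m) : inner ℂ (proj R x) y = inner ℂ x (proj R y) :=
  R.toSubmodule.inner_starProjection_left_eq_right x y

theorem inner_proj_of_mem (x : H2 m) {y : H2 m} (hy : y ∈ R) :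
    inner ℂ (proj R x) y = inner ℂ x y := by
  rw [inner_proj_left, proj_eq_self R hy]

theorem inner_sub_proj (x : H2 m) {y : H2 m} (hy : y ∈ R) : inner ℂ y (x - proj R x) = (0 : ℂ) := by
  rw [inner_sub_right, ← inner_proj_left, proj_eq_self R hy, sub_self]

end proj

theorem tprod_mem_tensor {R : Fin n → ClosedSubmodule ℂ (H2 1)} {g : Fin n → H2 1}
    (hg : ∀ i, g i ∈ R i) : tprod g ∈ tensor R :=
  subset_closure (Submodule.subset_span ⟨g, hg, rfl⟩)

theorem tensor_le {R : Fin n → ClosedSubmodule ℂ (H2 1)} {V : ClosedSubmodule ℂ (H2 n)}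
    (h : ∀ g : Fin n → H2 1, (∀ i, g i ∈ R i) → tprod g ∈ V) : tensor R ≤ V := by
  rw [tensor, Submodule.closure_le, Submodule.span_le]
  rintro _ ⟨g, hg, rfl⟩
  exact h g hg

/-- The projection onto `R₁ ⊗ ⋯ ⊗ Rₙ` is the tensor product of the projections onto the `Rᵢ`. -/
theorem proj_tensor_tprod (R : Fin n → ClosedSubmodule ℂ (H2 1)) (g : Fin n → H2 1) :
    proj (tensor R) (tprod g) = tprod fun i => proj (R i) (g i) := by
  refine (Submodule.eq_starProjection_of_mem_orthogonal
    (tprod_mem_tensor fun i => proj_mem (R i) (g i)) ?_)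
  have h : tensor R ≤ ⟨(ℂ ∙ (tprod g - tprod fun i => proj (R i) (g i)))ᗮ,
      Submodule.isClosed_orthogonal _⟩ := by
    refine tensor_le fun q hq => ?_
    refine Submodule.mem_orthogonal_singleton_iff_inner_right.2 ?_
    rw [inner_sub_left, inner_tprod, inner_tprod, sub_eq_zero]
    exact Finset.prod_congr rfl fun i _ => (inner_proj_of_mem (R i) (g i) (hq i)).symm
  exact fun f hf => Submodule.mem_orthogonal_singleton_iff_inner_left.1 (h hf)

/-- The subspace `H²(𝔻) ⊗ ⋯ ⊗ R ⊗ ⋯ ⊗ H²(𝔻)`, with `R` in the `i`-th factor. -/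
def cylinder (i : Fin n) (R : ClosedSubmodule ℂ (H2 1)) : ClosedSubmodule ℂ (H2 n) :=
  tensor (Function.update (fun _ => ⊤) i R)

theorem isSlot_proj_cylinder (i : Fin n) (R : ClosedSubmodule ℂ (H2 1)) :
    IsSlot i (proj R) (proj (cylinder i R)) := fun g => by
  rw [cylinder, proj_tensor_tprod]
  congr 1
  funext j
  rcases eq_or_ne j i with rfl | hj
  · rw [Function.update_self, Function.update_self]
  · rw [Function.update_of_ne hj, Function.update_of_ne hj]
    exact proj_eq_self _ (Submodule.mem_top)

/-! ### Doubly commuting quotient modules in terms of projections -/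

/-- A closed subspace is a quotient module iff it is invariant under the backward shifts. -/
theorem isQuotientModule_iff {Q : ClosedSubmodule ℂ (H2 n)} :
    IsQuotientModule Q ↔ ∀ i, ∀ f ∈ Q, (coordMul i).adjoint f ∈ Q := by
  constructor
  · intro h i f hf
    rw [← ClosedSubmodule.orthogonal_orthogonal_eq Q]
    refine (Submodule.mem_orthogonal _ _).2 fun u hu => ?_
    rw [ContinuousLinearMap.adjoint_inner_right]
    exact Submodule.inner_left_of_mem_orthogonal (K := Q.toSubmodule) hf (h i u hu)
  · intro h i u hu
    refine (Submodule.mem_orthogonal _ _).2 fun f hf => ?_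
    rw [← ContinuousLinearMap.adjoint_inner_left]
    exact Submodule.inner_right_of_mem_orthogonal (K := Q.toSubmodule) (h i f hf) hu

theorem coe_compression (Q : ClosedSubmodule ℂ (H2 n)) (i : Fin n) (f : Q.toSubmodule) :
    (compression Q i f : H2 n) = proj Q (coordMul i f) := rfl

theorem coe_adjoint_compression {Q : ClosedSubmodule ℂ (H2 n)} (hQ : IsQuotientModule Q)
    (i : Fin n) (f : Q.toSubmodule) :
    ((compression Q i).adjoint f : H2 n) = (coordMul i).adjoint f := by
  have h : (compression Q i).adjoint f =
      ⟨(coordMul i).adjoint f, isQuotientModule_iff.1 hQ i f f.2⟩ := by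
    refine ext_inner_right ℂ fun g => ?_
    rw [ContinuousLinearMap.adjoint_inner_left, Submodule.coe_inner, Submodule.coe_inner,
      coe_compression, ← inner_proj_left, proj_eq_self Q f.2,
      ContinuousLinearMap.adjoint_inner_left]
  rw [h]

theorem isDoublyCommuting_iff {Q : ClosedSubmodule ℂ (H2 n)} (hQ : IsQuotientModule Q) :
    IsDoublyCommuting Q ↔ ∀ i j, i ≠ j → ∀ f ∈ Q,
      proj Q (coordMul i ((coordMul j).adjoint f)) =
        (coordMul j).adjoint (proj Q (coordMul i f)) := by
  have key : ∀ i j, compression Q i ∘L (compression Q j).adjoint =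
      (compression Q j).adjoint ∘L compression Q i ↔ ∀ f ∈ Q,
      proj Q (coordMul i ((coordMul j).adjoint f)) =
        (coordMul j).adjoint (proj Q (coordMul i f)) := by
    intro i j
    rw [ContinuousLinearMap.ext_iff, Subtype.forall]
    refine forall₂_congr fun f hf => ?_
    rw [← Subtype.coe_inj, ContinuousLinearMap.comp_apply, ContinuousLinearMap.comp_apply,
      coe_compression, coe_adjoint_compression hQ, coe_adjoint_compression hQ, coe_compression]
  constructor
  · intro h i j hij
    rw [← key]
    rcases hij.lt_or_gt with hij | hij
    · exact h i j hij
    · have := congrArg ContinuousLinearMap.adjoint (h j i hij)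
      rw [ContinuousLinearMap.adjoint_comp, ContinuousLinearMap.adjoint_comp,
        ContinuousLinearMap.adjoint_adjoint] at this
      exact this
  · exact fun h i j hij => (key i j).2 (h i j hij.ne)

/-! ### Tensor products of backward shift invariant subspaces -/

theorem isQuotientModule_tensor {R : Fin n → ClosedSubmodule ℂ (H2 1)}
    (hR : ∀ i, ∀ f ∈ R i, shift.adjoint f ∈ R i) :
    IsQuotientModule (tensor R) := by
  refine isQuotientModule_iff.2 fun i f hf => ?_
  have h : tensor R ≤ (tensor R).comap (coordMul i).adjoint := tensor_le fun g hg => by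
    rw [ClosedSubmodule.mem_comap, (isSlot_coordMul i).adjoint g]
    refine tprod_mem_tensor fun j => ?_
    rcases eq_or_ne j i with rfl | hj
    · rw [Function.update_self]; exact hR j _ (hg j)
    · rw [Function.update_of_ne hj]; exact hg j
  exact h hf

theorem isDoublyCommuting_tensor {R : Fin n → ClosedSubmodule ℂ (H2 1)}
    (hR : ∀ i, ∀ f ∈ R i, shift.adjoint f ∈ R i) :
    IsDoublyCommuting (tensor R) := by
  refine (isDoublyCommuting_iff (isQuotientModule_tensor hR)).2 fun i j hij f hf => ?_
  set A := proj (tensor R) * (coordMul i * (coordMul j).adjoint) with hA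
  set B := (coordMul j).adjoint * (proj (tensor R) * coordMul i) with hB
  have h : tensor R ≤ ⟨(A - B).ker, (A - B).isClosed_ker⟩ := tensor_le fun g hg => by
    refine sub_eq_zero.2 ?_
    change proj (tensor R) (coordMul i ((coordMul j).adjoint (tprod g))) =
      (coordMul j).adjoint (proj (tensor R) (coordMul i (tprod g)))
    rw [(isSlot_coordMul j).adjoint g, isSlot_coordMul i, isSlot_coordMul i g, proj_tensor_tprod,
      proj_tensor_tprod, (isSlot_coordMul j).adjoint]
    congr 1
    funext k
    rcases eq_or_ne k j with rfl | hk
    · simp only [Function.update_self, Function.update_of_ne hij.symm]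
      rw [proj_eq_self _ (hR k _ (hg k)), proj_eq_self _ (hg k)]
    · rcases eq_or_ne k i with rfl | hk'
      · simp only [Function.update_self, Function.update_of_ne hij]
      · simp only [Function.update_of_ne hk, Function.update_of_ne hk']
  exact sub_eq_zero.1 (h hf)

/-! ### Slices of a quotient module -/

/-- The closed linear span of the one-variable slices of the elements of `Q` in the `i`-th
variable: fixing the exponents `aⱼ`, `j ≠ i`, in the power series of `f ∈ Q` leaves a power series
in `zᵢ`, which is the image of `f` under the adjoint of `x ↦ z^a ⊗ x`. -/
def sliceSpace (Q : ClosedSubmodule ℂ (H2 n)) (i : Fin n) : ClosedSubmodule ℂ (H2 1) :=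
  (Submodule.span ℂ {x | ∃ a : Fin n → ℕ, ∃ f ∈ Q,
    x = (insertAt (fun j => zPow (a j)) i).adjoint f}).closure

theorem slice_mem_sliceSpace {Q : ClosedSubmodule ℂ (H2 n)} (i : Fin n) (a : Fin n → ℕ)
    {f : H2 n} (hf : f ∈ Q) : (insertAt (fun j => zPow (a j)) i).adjoint f ∈ sliceSpace Q i :=
  subset_closure (Submodule.subset_span ⟨a, f, hf, rfl⟩)

theorem sliceSpace_le {Q : ClosedSubmodule ℂ (H2 n)} {i : Fin n} {V : ClosedSubmodule ℂ (H2 1)}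
    (h : ∀ a : Fin n → ℕ, ∀ f ∈ Q, (insertAt (fun j => zPow (a j)) i).adjoint f ∈ V) :
    sliceSpace Q i ≤ V := by
  rw [sliceSpace, Submodule.closure_le, Submodule.span_le]
  rintro _ ⟨a, f, hf, rfl⟩
  exact h a f hf

theorem adjoint_shift_mem_sliceSpace {Q : ClosedSubmodule ℂ (H2 n)}
    (hQ : ∀ i, ∀ f ∈ Q, (coordMul i).adjoint f ∈ Q) (i : Fin n) {x : H2 1}
    (hx : x ∈ sliceSpace Q i) : shift.adjoint x ∈ sliceSpace Q i := by
  have h : sliceSpace Q i ≤ (sliceSpace Q i).comap shift.adjoint := sliceSpace_le fun a f hf => by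
    set T := insertAt (fun j => zPow (a j)) i with hT
    have h1 : T ∘L shift = coordMul i ∘L T := by
      ext1 x
      simp only [ContinuousLinearMap.comp_apply, hT, insertAt_apply]
      rw [isSlot_coordMul i, Function.update_idem, Function.update_self]
    have h2 : shift.adjoint (T.adjoint f) = T.adjoint ((coordMul i).adjoint f) := by
      rw [← ContinuousLinearMap.comp_apply, ← ContinuousLinearMap.adjoint_comp, h1,
        ContinuousLinearMap.adjoint_comp, ContinuousLinearMap.comp_apply]
    rw [ClosedSubmodule.mem_comap, h2]
    exact slice_mem_sliceSpace i a (hQ i f hf)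
  exact h hx

theorem le_cylinder_sliceSpace (Q : ClosedSubmodule ℂ (H2 n)) (i : Fin n) :
    Q ≤ cylinder i (sliceSpace Q i) := by
  intro f hf
  refine mem_of_proj_eq _ (ext_inner_monomial fun k => ?_)
  rw [← inner_proj_left, ← tprod_zPow, isSlot_proj_cylinder, ← insertAt_apply,
    ← ContinuousLinearMap.adjoint_inner_right,
    inner_proj_of_mem _ _ (slice_mem_sliceSpace i k hf), ContinuousLinearMap.adjoint_inner_right,
    insertAt_apply]
  congr 2
  exact Function.update_eq_self i _

/-! ### Translates of a quotient module -/

/-- The images of the elements of `Q` under products of the operators `M_{z_j}`, `j ≠ i`. -/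
inductive IsTranslate (Q : ClosedSubmodule ℂ (H2 n)) (i : Fin n) : H2 n → Prop
  | of_mem {f : H2 n} : f ∈ Q → IsTranslate Q i f
  | coordMul {j : Fin n} {f : H2 n} : j ≠ i → IsTranslate Q i f → IsTranslate Q i (coordMul j f)

theorem IsTranslate.adjoint {Q : ClosedSubmodule ℂ (H2 n)}
    (hQ : ∀ i, ∀ f ∈ Q, (H2.coordMul i).adjoint f ∈ Q) {i j : Fin n} {w : H2 n}
    (hw : IsTranslate Q i w) : IsTranslate Q i ((H2.coordMul j).adjoint w) := by
  induction hw with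
  | of_mem hf => exact .of_mem (hQ j _ hf)
  | @coordMul k f hk hf ih =>
    rcases eq_or_ne j k with rfl | hjk
    · rwa [adjoint_coordMul_coordMul]
    · rw [adjoint_coordMul_comm hjk]
      exact .coordMul hk ih

/-- The orthogonal complement of the translates of `Q`. -/
def translatePerp (Q : ClosedSubmodule ℂ (H2 n)) (i : Fin n) : Submodule ℂ (H2 n) where
  carrier := {v | ∀ w, IsTranslate Q i w → inner ℂ w v = (0 : ℂ)}
  zero_mem' w _ := inner_zero_right w
  add_mem' hu hv w hw := by rw [inner_add_right, hu w hw, hv w hw, add_zero]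
  smul_mem' c v hv w hw := by rw [inner_smul_right, hv w hw, mul_zero]

theorem coordMul_mem_translatePerp {Q : ClosedSubmodule ℂ (H2 n)}
    (hQ : ∀ i, ∀ f ∈ Q, (coordMul i).adjoint f ∈ Q) {i j : Fin n} {v : H2 n}
    (hv : v ∈ translatePerp Q i) : coordMul j v ∈ translatePerp Q i := fun w hw => by
  rw [← ContinuousLinearMap.adjoint_inner_left]
  exact hv _ (hw.adjoint hQ)

theorem adjoint_mem_translatePerp {Q : ClosedSubmodule ℂ (H2 n)} {i j : Fin n} (hj : j ≠ i)
    {v : H2 n} (hv : v ∈ translatePerp Q i) : (coordMul j).adjoint v ∈ translatePerp Q i :=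
  fun w hw => by
    rw [ContinuousLinearMap.adjoint_inner_right]
    exact hv _ (.coordMul hj hw)

theorem pow_apply_mem {V : Submodule ℂ (H2 n)} {B : H2 n →L[ℂ] H2 n} (hB : ∀ f ∈ V, B f ∈ V)
    (m : ℕ) {f : H2 n} (hf : f ∈ V) : (B ^ m) f ∈ V := by
  induction m with
  | zero => exact hf
  | succ m ih => rw [pow_succ', mul_apply_eq_comp]; exact hB _ ih

theorem shift_rankOne (a b : ℕ) (u : H2 1) :
    (shift ^ b * (1 - shift * shift.adjoint) * shift.adjoint ^ a) u =
      inner ℂ (zPow a) u • zPow b := by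
  have h : (shift ^ b * (1 - shift * shift.adjoint) * shift.adjoint ^ a) u = (shift ^ b)
    ((shift.adjoint ^ a) u - shift (shift.adjoint ((shift.adjoint ^ a) u))) := rfl
  rw [h, one_sub_shift_mul_adjoint, inner_adjoint_shift_pow, map_smul, shift_pow_zPow, zero_add]

/-- The orthogonal complement of the translates of `Q` in the variables other than `zᵢ` is
orthogonal to the cylinder over the slices of `Q`: `T_b T_a*` with `T_a x = z^a ⊗ x` is a product of
rank-one operators in the variables other than `zᵢ`, so it maps this complement into itself. -/
theorem proj_cylinder_eq_zero {Q : ClosedSubmodule ℂ (H2 n)}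
    (hQ : ∀ i, ∀ f ∈ Q, (coordMul i).adjoint f ∈ Q) {i : Fin n} {u : H2 n}
    (hu : u ∈ translatePerp Q i) : proj (cylinder i (sliceSpace Q i)) u = 0 := by
  have key : ∀ a b : Fin n → ℕ, ∀ f ∈ Q,
      inner ℂ ((insertAt (fun j => zPow (b j)) i).adjoint f)
        ((insertAt (fun j => zPow (a j)) i).adjoint u) = (0 : ℂ) := by
    intro a b f hf
    obtain ⟨B, hB, hB'⟩ := exists_prod_rankOne (V := translatePerp Q i) (fun j => zPow (b j))
      (fun j => zPow (a j)) (Finset.univ.erase i) fun j hj => by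
        have hj' := Finset.ne_of_mem_erase hj
        have hS := isSlot_coordMul j
        refine ⟨_, _, ((hS.pow (b j)).mul ((IsSlot.one j).sub (hS.mul hS.adjoint))).mul
          (hS.adjoint.pow (a j)), shift_rankOne (a j) (b j), fun f hf => ?_⟩
        have h1 := pow_apply_mem (fun f => adjoint_mem_translatePerp hj') (a j) hf
        refine pow_apply_mem (fun f => coordMul_mem_translatePerp hQ) (b j) ?_
        exact Submodule.sub_mem _ h1
          (coordMul_mem_translatePerp hQ (adjoint_mem_translatePerp hj' h1))
    have hBT : insertAt (fun j => zPow (b j)) i ∘L (insertAt (fun j => zPow (a j)) i).adjoint =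
        B := by
      refine clm_ext_tprod fun h => ?_
      rw [hB', ContinuousLinearMap.comp_apply, adjoint_insertAt_tprod, map_smul, insertAt_apply]
      congr 2
      funext j
      by_cases hj : j = i
      · subst hj; simp
      · simp [hj]
    rw [ContinuousLinearMap.adjoint_inner_left, ← ContinuousLinearMap.comp_apply, hBT]
    exact hB u hu f (.of_mem hf)
  refine ext_inner_monomial fun k => ?_
  set T := insertAt (fun j => zPow (k j)) i with hT
  have hle : sliceSpace Q i ≤ ⟨(ℂ ∙ T.adjoint u)ᗮ, Submodule.isClosed_orthogonal _⟩ :=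
    sliceSpace_le fun b f hf => Submodule.mem_orthogonal_singleton_iff_inner_left.2 (key k b f hf)
  rw [← inner_proj_left, ← tprod_zPow, isSlot_proj_cylinder, ← insertAt_apply,
    ← ContinuousLinearMap.adjoint_inner_right, inner_zero_right]
  exact Submodule.mem_orthogonal_singleton_iff_inner_left.1 (hle (proj_mem _ _))

/-! ### Doubly commuting quotient modules are tensor products -/

/-- Double commutation says that `u = M_{z_i} f - P_Q M_{z_i} f` satisfies
`M_{z_j}* u = M_{z_i} f' - P_Q M_{z_i} f'` with `f' = M_{z_j}* f`, so that `u` is orthogonal not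
only to `Q` but also to all its translates. -/
theorem sub_proj_mem_translatePerp {Q : ClosedSubmodule ℂ (H2 n)}
    (hQ : ∀ i, ∀ f ∈ Q, (coordMul i).adjoint f ∈ Q)
    (hD : ∀ i j, i ≠ j → ∀ f ∈ Q, proj Q (coordMul i ((coordMul j).adjoint f)) =
      (coordMul j).adjoint (proj Q (coordMul i f))) (i : Fin n) {f : H2 n} (hf : f ∈ Q) :
    coordMul i f - proj Q (coordMul i f) ∈ translatePerp Q i := by
  intro w hw
  induction hw generalizing f with
  | of_mem hw => exact inner_sub_proj Q _ hw
  | @coordMul j w hj _ ih =>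
    rw [← ContinuousLinearMap.adjoint_inner_right, map_sub, adjoint_coordMul_comm hj,
      ← hD i j hj.symm f hf]
    exact ih (hQ j f hf)

theorem proj_cylinder_coordMul_mem {Q : ClosedSubmodule ℂ (H2 n)}
    (hQ : ∀ i, ∀ f ∈ Q, (coordMul i).adjoint f ∈ Q)
    (hD : ∀ i j, i ≠ j → ∀ f ∈ Q, proj Q (coordMul i ((coordMul j).adjoint f)) =
      (coordMul j).adjoint (proj Q (coordMul i f))) (i : Fin n) {f : H2 n} (hf : f ∈ Q) :
    proj (cylinder i (sliceSpace Q i)) (coordMul i f) ∈ Q := by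
  have h := proj_cylinder_eq_zero hQ (sub_proj_mem_translatePerp hQ hD i hf)
  rw [map_sub, sub_eq_zero,
    proj_eq_self _ (le_cylinder_sliceSpace Q i (proj_mem Q (coordMul i f)))] at h
  rw [h]
  exact proj_mem Q _

/-- The compression of the shift to an `S*`-invariant subspace satisfies `(P S)^b P = P S^b`, here
applied to the constant function `1`. -/
theorem proj_shift_pow {R : ClosedSubmodule ℂ (H2 1)} (hR : ∀ f ∈ R, shift.adjoint f ∈ R) (b : ℕ) :
    ((proj R * shift) ^ b) (proj R (zPow 0)) = proj R (zPow b) := by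
  induction b with
  | zero => rfl
  | succ b ih =>
    rw [pow_succ', mul_apply_eq_comp, ih, mul_apply_eq_comp, ← shift_zPow]
    refine ext_inner_left ℂ fun y => ?_
    have h := inner_sub_proj R (zPow b) (hR _ (proj_mem R y))
    rw [ContinuousLinearMap.adjoint_inner_left, map_sub, inner_sub_right, sub_eq_zero] at h
    rw [← inner_proj_left, ← inner_proj_left, h]

theorem proj_shift_rankOne {R : ClosedSubmodule ℂ (H2 1)} (hR : ∀ f ∈ R, shift.adjoint f ∈ R)
    (a b : ℕ) (u : H2 1) :
    ((proj R * shift) ^ b * (proj R - proj R * shift * shift.adjoint) * shift.adjoint ^ a) u =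
      inner ℂ (zPow a) u • proj R (zPow b) := by
  have h : ((proj R * shift) ^ b * (proj R - proj R * shift * shift.adjoint) *
      shift.adjoint ^ a) u = ((proj R * shift) ^ b) (proj R ((shift.adjoint ^ a) u) -
        proj R (shift (shift.adjoint ((shift.adjoint ^ a) u)))) := rfl
  rw [h, ← map_sub, one_sub_shift_mul_adjoint, inner_adjoint_shift_pow, map_smul, map_smul,
    proj_shift_pow hR]

theorem le_tensor_sliceSpace (Q : ClosedSubmodule ℂ (H2 n)) : Q ≤ tensor (sliceSpace Q) := by
  intro f hf
  refine mem_of_proj_eq _ (ext_inner_tprod fun g => ?_)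
  have h : ∀ s : Finset (Fin n), inner ℂ (tprod
      (s.piecewise (fun i => proj (sliceSpace Q i) (g i)) g)) f = inner ℂ (tprod g) f := by
    intro s
    induction s using Finset.induction_on with
    | empty => simp
    | insert j s hj ih =>
      rw [← ih, ← proj_eq_self _ (le_cylinder_sliceSpace Q j hf), ← inner_proj_left,
        ← inner_proj_left, isSlot_proj_cylinder, isSlot_proj_cylinder, Finset.piecewise_insert,
        Function.update_idem, Function.update_self, Finset.piecewise_eq_of_notMem _ _ _ hj,
        proj_eq_self _ (proj_mem _ _)]
  rw [← inner_proj_left, proj_tensor_tprod, ← h Finset.univ, Finset.piecewise_univ]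

theorem mem_of_monomial_mem {V : ClosedSubmodule ℂ (H2 n)} (h : ∀ k, monomial k ∈ V) (f : H2 n) :
    f ∈ V := by
  have h1 : Submodule.span ℂ (range (monomial (n := n))) ≤ V.toSubmodule :=
    Submodule.span_le.2 (by rintro _ ⟨k, rfl⟩; exact h k)
  exact closure_minimal h1 V.isClosed (dense_span_monomial f)

theorem eq_tensor_sliceSpace (hn : 1 ≤ n) {Q : ClosedSubmodule ℂ (H2 n)}
    (hQ : ∀ i, ∀ f ∈ Q, (coordMul i).adjoint f ∈ Q)
    (hD : ∀ i j, i ≠ j → ∀ f ∈ Q, proj Q (coordMul i ((coordMul j).adjoint f)) =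
      (coordMul j).adjoint (proj Q (coordMul i f))) : Q = tensor (sliceSpace Q) := by
  refine le_antisymm (le_tensor_sliceSpace Q) ?_
  by_cases h0 : ∀ f ∈ Q, f = 0
  -- For `Q = 0` all slices vanish; as there is at least one factor, so does their tensor product.
  · refine tensor_le fun g hg => ?_
    have h1 : sliceSpace Q ⟨0, hn⟩ ≤ ⊥ := sliceSpace_le fun a f hf => by
      rw [h0 f hf, map_zero]; exact zero_mem _
    have h2 : g ⟨0, hn⟩ = 0 := ClosedSubmodule.mem_bot.1 (h1 (hg ⟨0, hn⟩))
    have h3 : tprod g = 0 := by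
      rw [← norm_eq_zero, norm_tprod]
      exact Finset.prod_eq_zero (Finset.mem_univ ⟨0, hn⟩) (by rw [h2, norm_zero])
    rw [h3]; exact zero_mem _
  · push Not at h0
    obtain ⟨f, hf, hf0⟩ := h0
    obtain ⟨a, ha⟩ : ∃ a, inner ℂ (monomial a) f ≠ 0 := by
      by_contra! h
      exact hf0 (ext_inner_monomial fun k => by rw [h k, inner_zero_right])
    -- The product over `i` of the operators `|P z^{bᵢ}⟩⟨z^{aᵢ}|` maps `f` to a nonzero multiple of
    -- the tensor product of the vectors `P z^{bᵢ}`.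
    have hmem : ∀ b : Fin n → ℕ, tprod (fun i => proj (sliceSpace Q i) (zPow (b i))) ∈ Q := by
      intro b
      obtain ⟨B, hB, hB'⟩ := exists_prod_rankOne (V := Q.toSubmodule)
        (fun i => proj (sliceSpace Q i) (zPow (b i))) (fun i => zPow (a i)) Finset.univ
        fun i _ => by
          have hS := isSlot_coordMul i
          have hP := isSlot_proj_cylinder i (sliceSpace Q i)
          refine ⟨_, _, (((hP.mul hS).pow (b i)).mul (hP.sub ((hP.mul hS).mul hS.adjoint))).mul
            (hS.adjoint.pow (a i)), proj_shift_rankOne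
              (fun f => adjoint_shift_mem_sliceSpace hQ i) (a i) (b i), fun f hf => ?_⟩
          have h1 := pow_apply_mem (fun f => hQ i f) (a i) hf
          refine pow_apply_mem (fun f => proj_cylinder_coordMul_mem hQ hD i) (b i) ?_
          refine Submodule.sub_mem _ ?_ (proj_cylinder_coordMul_mem hQ hD i (hQ i _ h1))
          exact (congrArg (· ∈ Q) (proj_eq_self _ (le_cylinder_sliceSpace Q i h1))).mpr h1
      have hBf : B = (innerSL ℂ (monomial a)).smulRight
          (tprod fun i => proj (sliceSpace Q i) (zPow (b i))) := by
        refine clm_ext_tprod fun h => ?_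
        rw [hB', ContinuousLinearMap.smulRight_apply, innerSL_apply_apply, ← tprod_zPow,
          inner_tprod, Finset.piecewise_univ]
      have h2 : inner ℂ (monomial a) f • tprod (fun i => proj (sliceSpace Q i) (zPow (b i))) ∈ Q := by
        have := hB f hf
        rwa [hBf] at this
      exact (Q.toSubmodule.smul_mem_iff ha).1 h2
    intro g hg
    have h3 : g ∈ Q.comap (proj (tensor (sliceSpace Q))) := mem_of_monomial_mem (fun k => by
      rw [ClosedSubmodule.mem_comap, ← tprod_zPow, proj_tensor_tprod]
      exact hmem k) g
    rwa [ClosedSubmodule.mem_comap, proj_eq_self _ hg] at h3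

/-! ### Boundary values -/

/-- The normalized Lebesgue measure on the circle. -/
abbrev circleMeasure : Measure UnitAddCircle := AddCircle.haarAddCircle

theorem orthonormal_fourierLp_nat :
    Orthonormal ℂ fun k : Fin 1 → ℕ => fourierLp (T := 1) 2 (k 0 : ℤ) :=
  orthonormal_fourier.comp (fun k : Fin 1 → ℕ => (k 0 : ℤ)) fun k l h => by
    funext i
    rw [Subsingleton.elim i 0]
    exact Nat.cast_injective (R := ℤ) h

/-- The boundary value of `f ∈ H²(𝔻)`: the element of `L²` of the circle whose Fourier
coefficients are the Taylor coefficients of `f`. -/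
def boundary : H2 1 →ₗᵢ[ℂ] Lp ℂ 2 circleMeasure :=
  orthonormal_fourierLp_nat.orthogonalFamily.linearIsometry.comp (coeffsEquiv 1).toLinearIsometry

theorem boundary_zPow (m : ℕ) : boundary (zPow m) = fourierLp 2 (m : ℤ) := by
  have h : boundary (zPow m) = orthonormal_fourierLp_nat.orthogonalFamily.linearIsometry
      (lp.single 2 (fun _ => m) 1) := by
    rw [← coeffs_monomial]
    rfl
  rw [h, OrthogonalFamily.linearIsometry_apply_single]
  simp

theorem inner_fourierLp_boundary (l : ℤ) (f : H2 1) :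
    inner ℂ (fourierLp (T := 1) 2 l) (boundary f) =
      if 0 ≤ l then inner ℂ (zPow l.toNat) f else 0 := by
  have h : innerSL ℂ (fourierLp (T := 1) 2 l) ∘L boundary.toContinuousLinearMap =
      if 0 ≤ l then innerSL ℂ (zPow l.toNat) else 0 := by
    refine clm_ext_zPow fun m => ?_
    have h1 : inner ℂ (fourierLp (T := 1) 2 l) (fourierLp (T := 1) 2 (m : ℤ)) =
        if l = m then (1 : ℂ) else 0 := orthonormal_iff_ite.1 orthonormal_fourier l m
    rw [ContinuousLinearMap.comp_apply, innerSL_apply_apply, LinearIsometry.coe_toContinuousLinearMap,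
      boundary_zPow, h1]
    by_cases hl : 0 ≤ l
    · lift l to ℕ using hl
      rw [if_pos (Int.natCast_nonneg l), innerSL_apply_apply, inner_zPow]
      simp
    · rw [if_neg hl, if_neg (by omega)]
      rfl
  have h2 := congrArg (fun A : H2 1 →L[ℂ] ℂ => A f) h
  by_cases hl : 0 ≤ l
  · rw [if_pos hl] at h2 ⊢; exact h2
  · rw [if_neg hl] at h2 ⊢; exact h2

theorem ext_inner_fourierLp {F G : Lp ℂ 2 circleMeasure}
    (h : ∀ l, inner ℂ (fourierLp (T := 1) 2 l) F = inner ℂ (fourierLp (T := 1) 2 l) G) :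
    F = G := by
  refine (fourierBasis (T := 1)).repr.injective (lp.ext (funext fun l => ?_))
  rw [HilbertBasis.repr_apply_apply, HilbertBasis.repr_apply_apply, coe_fourierBasis]
  exact h l

theorem inner_fourierLp (l : ℤ) (F : Lp ℂ 2 circleMeasure) :
    inner ℂ (fourierLp (T := 1) 2 l) F = ∫ t, fourier (-l) t * F t ∂circleMeasure := by
  rw [L2.inner_def]
  refine integral_congr_ae ?_
  filter_upwards [coeFn_fourierLp (T := 1) 2 l] with t ht
  rw [ht, fourier_neg]
  exact mul_comm _ _

theorem integral_fourier_mul_boundary (l : ℤ) (f : H2 1) :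
    ∫ t, fourier (-l) t * boundary f t ∂circleMeasure =
      if 0 ≤ l then inner ℂ (zPow l.toNat) f else 0 := by
  rw [← inner_fourierLp, inner_fourierLp_boundary]

theorem memLp_fourier_mul (k : ℤ) (F : Lp ℂ 2 circleMeasure) :
    MemLp (fun t => fourier k t * F t) 2 circleMeasure := by
  refine MemLp.of_le (Lp.memLp F)
    ((map_continuous (fourier k)).aestronglyMeasurable.mul (Lp.aestronglyMeasurable F))
    (Eventually.of_forall fun t => ?_)
  rw [norm_mul, fourier_apply, Circle.norm_coe, one_mul]

theorem boundary_shift_pow (k : ℕ) (f : H2 1) :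
    boundary ((shift ^ k) f) =ᵐ[circleMeasure] fun t => fourier k t * boundary f t := by
  have hm := memLp_fourier_mul k (boundary f)
  have h : boundary ((shift ^ k) f) = hm.toLp := by
    refine ext_inner_fourierLp fun l => ?_
    have h1 : inner ℂ (fourierLp (T := 1) 2 l) hm.toLp =
        ∫ t, fourier (-(l - k)) t * boundary f t ∂circleMeasure := by
      rw [inner_fourierLp]
      refine integral_congr_ae ?_
      filter_upwards [hm.coeFn_toLp] with t ht
      rw [ht, ← mul_assoc, ← fourier_add]
      congr 2
      ring_nf
    have h2 : ∀ m, inner ℂ (zPow m) ((shift ^ k) f) =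
        if k ≤ m then inner ℂ (zPow (m - k)) f else 0 := by
      intro m
      have h3 : innerSL ℂ (zPow m) ∘L shift ^ k =
          if k ≤ m then innerSL ℂ (zPow (m - k)) else 0 := by
        refine clm_ext_zPow fun j => ?_
        rw [ContinuousLinearMap.comp_apply, shift_pow_zPow, innerSL_apply_apply, inner_zPow]
        by_cases hkm : k ≤ m
        · rw [if_pos hkm, innerSL_apply_apply, inner_zPow]
          exact if_congr (by omega) rfl rfl
        · rw [if_neg hkm, if_neg (by omega)]
          rfl
      have h4 := congrArg (fun A : H2 1 →L[ℂ] ℂ => A f) h3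
      by_cases hkm : k ≤ m
      · rw [if_pos hkm] at h4 ⊢; exact h4
      · rw [if_neg hkm] at h4 ⊢; exact h4
    rw [h1, integral_fourier_mul_boundary, inner_fourierLp_boundary, h2]
    by_cases hl : (0 : ℤ) ≤ l - k
    · rw [if_pos hl, if_pos (by omega), if_pos (by omega)]
      congr 2
      omega
    · rw [if_neg hl]
      split_ifs with h5 h6
      · omega
      · rfl
      · rfl
  rw [h]
  exact hm.coeFn_toLp

theorem inner_shift_pow (k : ℕ) (f g : H2 1) : inner ℂ ((shift ^ k) f) g =
    ∫ t, fourier (-(k : ℤ)) t * (starRingEnd ℂ (boundary f t) * boundary g t) ∂circleMeasure := by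
  rw [← boundary.inner_map_map, L2.inner_def]
  refine integral_congr_ae ?_
  filter_upwards [boundary_shift_pow k f] with t ht
  rw [ht, fourier_neg, RCLike.inner_apply, map_mul]
  ring

/-! ### Uniqueness of Fourier coefficients -/

theorem integral_continuous_mul_eq_zero {G : UnitAddCircle → ℂ} (hG : Integrable G circleMeasure)
    (h : ∀ k : ℤ, ∫ t, fourier k t * G t ∂circleMeasure = 0) (φ : C(UnitAddCircle, ℂ)) :
    ∫ t, φ t * G t ∂circleMeasure = 0 := by
  have hint : ∀ φ : C(UnitAddCircle, ℂ), Integrable (fun t => φ t * G t) circleMeasure :=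
    fun φ => hG.bdd_mul (map_continuous φ).aestronglyMeasurable
      (Eventually.of_forall fun t => φ.norm_coe_le_norm t)
  let L : C(UnitAddCircle, ℂ) →L[ℂ] ℂ := LinearMap.mkContinuous
    { toFun := fun φ => ∫ t, φ t * G t ∂circleMeasure
      map_add' := fun φ ψ => by
        rw [← integral_add (hint φ) (hint ψ)]
        exact integral_congr_ae (Eventually.of_forall fun t => add_mul _ _ _)
      map_smul' := fun c φ => by
        rw [RingHom.id_apply, smul_eq_mul, ← integral_const_mul]
        exact integral_congr_ae (Eventually.of_forall fun t => mul_assoc _ _ _) }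
    (∫ t, ‖G t‖ ∂circleMeasure) (fun φ => by
      rw [LinearMap.coe_mk, AddHom.coe_mk, mul_comm, ← integral_const_mul]
      refine norm_integral_le_of_norm_le (hG.norm.const_mul _) (Eventually.of_forall fun t => ?_)
      rw [norm_mul]
      exact mul_le_mul_of_nonneg_right (φ.norm_coe_le_norm t) (norm_nonneg _))
  have hL : L = 0 := by
    refine ContinuousLinearMap.ext_on (s := range (fourier (T := 1))) ?_ ?_
    · rw [Submodule.dense_iff_topologicalClosure_eq_top, span_fourier_closure_eq_top]
    · rintro _ ⟨k, rfl⟩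
      exact h k
  exact congrArg (fun A : C(UnitAddCircle, ℂ) →L[ℂ] ℂ => A φ) hL

/-- An integrable function on the circle with vanishing Fourier coefficients vanishes. -/
theorem ae_eq_zero_of_integral_fourier_mul {G : UnitAddCircle → ℂ}
    (hG : Integrable G circleMeasure) (h : ∀ k : ℤ, ∫ t, fourier k t * G t ∂circleMeasure = 0) :
    G =ᵐ[circleMeasure] 0 := by
  refine ae_eq_zero_of_forall_setIntegral_isClosed_eq_zero hG fun s hs => ?_
  have hδ : ∀ m : ℕ, (0 : ℝ) < 1 / ((m : ℝ) + 1) := fun m => Nat.one_div_pos_of_nat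
  set χ : ℕ → UnitAddCircle → ℂ := fun m t => ((thickenedIndicator (hδ m) s t : ℝ) : ℂ) with hχ
  have hχc : ∀ m, Continuous (χ m) := fun m =>
    Complex.continuous_ofReal.comp (NNReal.continuous_coe.comp (map_continuous _))
  have h0 : ∀ m, ∫ t, χ m t * G t ∂circleMeasure = 0 := fun m =>
    integral_continuous_mul_eq_zero hG h ⟨χ m, hχc m⟩
  have hlim : Tendsto (fun m => ∫ t, χ m t * G t ∂circleMeasure) atTop
      (𝓝 (∫ t, s.indicator G t ∂circleMeasure)) := by
    refine tendsto_integral_of_dominated_convergence (fun t => ‖G t‖)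
      (fun m => (hχc m).aestronglyMeasurable.mul hG.aestronglyMeasurable) hG.norm
      (fun m => Eventually.of_forall fun t => ?_) (Eventually.of_forall fun t => ?_)
    · rw [norm_mul, Complex.norm_real, Real.norm_of_nonneg (NNReal.coe_nonneg _)]
      exact mul_le_of_le_one_left (norm_nonneg _)
        (by exact_mod_cast thickenedIndicator_le_one (hδ m) s t)
    · have h1 := tendsto_pi_nhds.1 (thickenedIndicator_tendsto_indicator_closure hδ
        tendsto_one_div_add_atTop_nhds_zero_nat s) t
      rw [hs.closure_eq] at h1
      have h2 := ((Complex.continuous_ofReal.comp NNReal.continuous_coe).tendsto _).comp h1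
      convert! h2.mul_const (G t) using 2
      by_cases ht : t ∈ s <;> simp [ht]
  rw [← integral_indicator hs.measurableSet]
  exact tendsto_nhds_unique hlim (by simp only [h0]; exact tendsto_const_nhds)

/-! ### The Poisson integral -/

theorem poissonKernel_toCircle (z : ℂ) (t : UnitAddCircle) :
    poissonKernel 0 z (AddCircle.toCircle t) =
      (1 - ‖z‖ ^ 2) / ‖(AddCircle.toCircle t : ℂ) - z‖ ^ 2 := by
  rw [poissonKernel_def, sub_zero, sub_zero, Circle.norm_coe, one_pow]

theorem poissonKernel_toCircle_nonneg {z : ℂ} (hz : ‖z‖ < 1) (t : UnitAddCircle) :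
    0 ≤ poissonKernel 0 z (AddCircle.toCircle t) := by
  rw [poissonKernel_toCircle]
  have : ‖z‖ ^ 2 ≤ 1 := pow_le_one₀ (norm_nonneg z) hz.le
  exact div_nonneg (by linarith) (by positivity)

theorem toCircle_sub_ne_zero {z : ℂ} (hz : ‖z‖ < 1) (t : UnitAddCircle) :
    (AddCircle.toCircle t : ℂ) - z ≠ 0 := by
  intro h
  rw [← sub_eq_zero.1 h, Circle.norm_coe] at hz
  exact lt_irrefl _ hz

theorem continuous_poissonKernel {z : ℂ} (hz : ‖z‖ < 1) :
    Continuous fun t : UnitAddCircle => poissonKernel 0 z (AddCircle.toCircle t) := by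
  simp_rw [poissonKernel_toCircle]
  refine continuous_const.div ?_ fun t =>
    pow_ne_zero 2 (norm_ne_zero_iff.2 (toCircle_sub_ne_zero hz t))
  have := AddCircle.continuous_toCircle (T := 1)
  fun_prop

theorem integrable_poissonKernel_mul {z : ℂ} (hz : ‖z‖ < 1) {φ : UnitAddCircle → ℝ}
    (hφ : Integrable φ circleMeasure) :
    Integrable (fun t => poissonKernel 0 z (AddCircle.toCircle t) * φ t) circleMeasure := by
  obtain ⟨C, hC⟩ := isCompact_univ.exists_bound_of_continuousOn
    (continuous_poissonKernel hz).continuousOn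
  exact hφ.bdd_mul (continuous_poissonKernel hz).aestronglyMeasurable
    (Eventually.of_forall fun t => hC t (mem_univ t))

theorem integrable_boundary (f : H2 1) : Integrable (boundary f) circleMeasure :=
  (Lp.memLp (boundary f)).integrable one_le_two

theorem fourier_natCast_eq_pow (k : ℕ) (t : UnitAddCircle) :
    fourier (k : ℤ) t = (AddCircle.toCircle t : ℂ) ^ k := by
  simp [fourier_apply, AddCircle.toCircle_nsmul]

/-- The Poisson kernel as the sum of its Fourier series, split into the part with frequencies
`≤ 0` and the part with frequencies `> 0`. -/
theorem hasSum_poissonKernel {z : ℂ} (hz : ‖z‖ < 1) (t : UnitAddCircle) :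
    HasSum (fun k : ℕ => z ^ k * fourier (-(k : ℤ)) t +
      starRingEnd ℂ z ^ (k + 1) * fourier ((k + 1 : ℕ) : ℤ) t)
      (poissonKernel 0 z (AddCircle.toCircle t) : ℂ) := by
  set ζ : ℂ := (AddCircle.toCircle t : ℂ) with hζ
  have hζ1 : ζ * starRingEnd ℂ ζ = 1 := by
    rw [Complex.mul_conj, Complex.normSq_eq_norm_sq, hζ, Circle.norm_coe]; simp
  have hw : ‖z * starRingEnd ℂ ζ‖ < 1 := by
    rwa [norm_mul, RCLike.norm_conj, hζ, Circle.norm_coe, mul_one]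
  have hw' : ‖starRingEnd ℂ z * ζ‖ < 1 := by
    rwa [norm_mul, RCLike.norm_conj, hζ, Circle.norm_coe, mul_one]
  have h := (hasSum_geometric_of_norm_lt_one hw).add
    ((hasSum_geometric_of_norm_lt_one hw').mul_left (starRingEnd ℂ z * ζ))
  convert! h using 1
  · funext k
    rw [fourier_neg, fourier_natCast_eq_pow, fourier_natCast_eq_pow, map_pow, ← hζ]
    ring
  · have hd : ζ - z ≠ 0 := toCircle_sub_ne_zero hz t
    have hd' : starRingEnd ℂ ζ - starRingEnd ℂ z ≠ 0 := by
      rw [← map_sub]; exact (map_ne_zero _).2 hd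
    have e1 : 1 - z * starRingEnd ℂ ζ = starRingEnd ℂ ζ * (ζ - z) := by
      linear_combination -hζ1
    have e2 : 1 - starRingEnd ℂ z * ζ = ζ * (starRingEnd ℂ ζ - starRingEnd ℂ z) := by
      linear_combination -hζ1
    have hζ0 : ζ ≠ 0 := left_ne_zero_of_mul_eq_one hζ1
    have hζ0' : starRingEnd ℂ ζ ≠ 0 := right_ne_zero_of_mul_eq_one hζ1
    have e3 : ((‖ζ - z‖ ^ 2 : ℝ) : ℂ) = (ζ - z) * (starRingEnd ℂ ζ - starRingEnd ℂ z) := by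
      rw [← map_sub, Complex.mul_conj, Complex.normSq_eq_norm_sq]
    have e4 : ((‖z‖ ^ 2 : ℝ) : ℂ) = z * starRingEnd ℂ z := by
      rw [Complex.mul_conj, Complex.normSq_eq_norm_sq]
    rw [poissonKernel_toCircle, ← hζ, Complex.ofReal_div, e3, Complex.ofReal_sub, e4, e1, e2,
      Complex.ofReal_one]
    field_simp
    linear_combination -starRingEnd ℂ z * hζ1

/-- A function in `H²(𝔻)` is the Poisson integral of its boundary value. -/
theorem eq_integral_poissonKernel (f : H2 1) {z : ℂ} (hz : ‖z‖ < 1) :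
    f (fun _ => z) = ∫ t, (poissonKernel 0 z (AddCircle.toCircle t) : ℂ) * boundary f t
      ∂circleMeasure := by
  set F : ℕ → UnitAddCircle → ℂ := fun k t => (z ^ k * fourier (-(k : ℤ)) t +
    starRingEnd ℂ z ^ (k + 1) * fourier ((k + 1 : ℕ) : ℤ) t) * boundary f t with hF
  have hmul : ∀ k : ℤ, Integrable (fun t => fourier k t * boundary f t) circleMeasure :=
    fun k => (memLp_fourier_mul k (boundary f)).integrable one_le_two
  have hFe : ∀ k, F k = fun t => z ^ k * (fourier (-(k : ℤ)) t * boundary f t) +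
      starRingEnd ℂ z ^ (k + 1) * (fourier ((k + 1 : ℕ) : ℤ) t * boundary f t) := by
    intro k; funext t; simp only [hF]; ring
  have hint : ∀ k, Integrable (F k) circleMeasure := fun k => by
    rw [hFe]
    exact ((hmul _).const_mul _).add ((hmul _).const_mul _)
  have hFn : ∀ k t, ‖F k t‖ ≤ ‖z‖ ^ k * (2 * ‖boundary f t‖) := by
    intro k t
    have h1 : ‖F k t‖ ≤ (‖z‖ ^ k + ‖z‖ ^ (k + 1)) * ‖boundary f t‖ := by
      simp only [hF, norm_mul]
      refine mul_le_mul_of_nonneg_right ((norm_add_le _ _).trans ?_) (norm_nonneg _)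
      simp only [norm_mul, norm_pow, RCLike.norm_conj, fourier_apply, Circle.norm_coe, mul_one]
      exact le_rfl
    have h2 : ‖z‖ ^ (k + 1) ≤ ‖z‖ ^ k := pow_le_pow_of_le_one (norm_nonneg z) hz.le k.le_succ
    nlinarith [norm_nonneg (boundary f t)]
  have hsum := hasSum_integral_of_summable_integral_norm hint (by
    refine Summable.of_nonneg_of_le (fun k => integral_nonneg fun t => norm_nonneg _) (fun k => ?_)
      ((summable_geometric_of_lt_one (norm_nonneg z) hz).mul_right
        (∫ t, 2 * ‖boundary f t‖ ∂circleMeasure))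
    rw [← integral_const_mul]
    exact integral_mono (hint k).norm (((integrable_boundary f).norm.const_mul 2).const_mul _)
      (hFn k))
  have hterm : ∀ k, ∫ t, F k t ∂circleMeasure = taylorCoeff f (fun _ => k) * z ^ k := by
    intro k
    have h1 := integral_fourier_mul_boundary (k : ℤ) f
    have h2 := integral_fourier_mul_boundary (-((k + 1 : ℕ) : ℤ)) f
    rw [if_pos (by omega), Int.toNat_natCast, zPow, inner_monomial] at h1
    rw [if_neg (by omega), neg_neg] at h2
    rw [hFe, integral_add ((hmul _).const_mul _) ((hmul _).const_mul _), integral_const_mul,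
      integral_const_mul, h1, h2, mul_zero, add_zero, mul_comm]
  have h3 : HasSum (fun k : ℕ => taylorCoeff f (fun _ => k) * z ^ k) (f fun _ => z) := by
    have := hasSum_taylor f (z := fun _ => z) fun _ => hz
    rw [← (Equiv.funUnique (Fin 1) ℕ).symm.hasSum_iff] at this
    refine this.congr_fun fun k => ?_
    rw [Function.comp_apply, funUnique_symm_apply, Fin.prod_univ_one]
  simp_rw [hterm] at hsum
  rw [h3.unique hsum]
  refine integral_congr_ae (Eventually.of_forall fun t => ?_)
  exact ((hasSum_poissonKernel hz t).mul_right (boundary f t)).tsum_eq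

theorem integral_poissonKernel {z : ℂ} (hz : ‖z‖ < 1) :
    ∫ t, poissonKernel 0 z (AddCircle.toCircle t) ∂circleMeasure = 1 := by
  have h := eq_integral_poissonKernel (zPow 0) hz
  rw [zPow, monomial_apply _ fun _ => hz] at h
  have h1 : ∫ t, (poissonKernel 0 z (AddCircle.toCircle t) : ℂ) * boundary (monomial fun _ => 0) t
      ∂circleMeasure = ∫ t, (poissonKernel 0 z (AddCircle.toCircle t) : ℂ) ∂circleMeasure := by
    refine integral_congr_ae ?_
    have := coeFn_fourierLp (T := 1) 2 (0 : ℤ)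
    filter_upwards [this] with t ht
    have h2 := boundary_zPow 0
    rw [Nat.cast_zero] at h2
    rw [zPow] at h2
    rw [h2, ht, fourier_zero, mul_one]
  rw [h1, integral_complex_ofReal] at h
  simpa using h.symm

theorem norm_le_one_of_boundary (f : H2 1) (hf : ∀ᵐ t ∂circleMeasure, ‖boundary f t‖ ≤ 1) {z : ℂ}
    (hz : ‖z‖ < 1) : ‖f fun _ => z‖ ≤ 1 := by
  rw [eq_integral_poissonKernel f hz]
  refine (norm_integral_le_of_norm_le ?_ ?_).trans_eq (integral_poissonKernel hz)
  · exact (continuous_poissonKernel hz).integrable_of_hasCompactSupport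
      (HasCompactSupport.of_compactSpace _)
  · filter_upwards [hf] with t ht
    rw [norm_mul, Complex.norm_real, Real.norm_of_nonneg (poissonKernel_toCircle_nonneg hz t)]
    exact mul_le_of_le_one_right (poissonKernel_toCircle_nonneg hz t) ht

/-! ### Radial limits -/

theorem norm_toCircle_sub_one_ge (y : UnitAddCircle) :
    4 * ‖y‖ ≤ ‖(AddCircle.toCircle y : ℂ) - 1‖ := by
  obtain ⟨x, rfl⟩ := QuotientAddGroup.mk_surjective y
  change 4 * ‖(x : UnitAddCircle)‖ ≤ ‖(AddCircle.toCircle (x : UnitAddCircle) : ℂ) - 1‖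
  set x' : ℝ := x - round x with hx'
  have h1 : (x : UnitAddCircle) = (x' : UnitAddCircle) := by
    rw [hx', AddCircle.coe_sub]
    have : ((round x : ℝ) : UnitAddCircle) = 0 := by
      rw [AddCircle.coe_eq_zero_iff]
      exact ⟨round x, by simp⟩
    rw [this, sub_zero]
  have h2 : |x'| ≤ 1 / 2 := abs_sub_round x
  have hπ := Real.pi_pos
  have h3 : ‖(x : UnitAddCircle)‖ = |x'| := UnitAddCircle.norm_eq
  have h4 : 2 / Real.pi * |Real.pi * x'| ≤ |Real.sin (Real.pi * x')| := by
    refine Real.mul_abs_le_abs_sin ?_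
    rw [abs_mul, abs_of_pos hπ]
    nlinarith
  rw [h3, h1, AddCircle.toCircle_apply_mk, Circle.coe_exp, mul_comm _ Complex.I,
    Complex.norm_exp_I_mul_ofReal_sub_one, norm_mul, Real.norm_eq_abs, Real.norm_eq_abs,
    abs_two, show 2 * Real.pi / 1 * x' / 2 = Real.pi * x' by ring]
  rw [abs_mul, abs_of_pos hπ, ← mul_assoc, div_mul_cancel₀ _ hπ.ne'] at h4
  linarith

/-- Near the boundary point `e^{2πix}` the Poisson kernel at `r e^{2πix}`, with `δ = 1 - r`, is
at most `2 / δ` and decays like `δ / ‖t - x‖²`. -/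
theorem poissonKernel_mul_le {r : ℝ} (hr : r ∈ Ico (0 : ℝ) 1) (x t : UnitAddCircle) :
    poissonKernel 0 (r * AddCircle.toCircle x) (AddCircle.toCircle t) * (1 - r) ≤ 2 ∧
      poissonKernel 0 (r * AddCircle.toCircle x) (AddCircle.toCircle t) * (2 * ‖t - x‖ ^ 2) ≤
        1 - r := by
  set d := ‖(AddCircle.toCircle t : ℂ) - r * AddCircle.toCircle x‖ with hd
  have hrx : ‖(r * AddCircle.toCircle x : ℂ)‖ = r := by
    rw [norm_mul, Circle.norm_coe, mul_one, Complex.norm_real, Real.norm_of_nonneg hr.1]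
  have h1 : 1 - r ≤ d := by
    have := norm_sub_norm_le (AddCircle.toCircle t : ℂ) (r * AddCircle.toCircle x)
    rwa [Circle.norm_coe, hrx] at this
  have h2 : 2 * ‖t - x‖ ≤ d := by
    have h3 : ‖(AddCircle.toCircle t : ℂ) - AddCircle.toCircle x‖ ≤ d + (1 - r) := by
      refine (norm_sub_le_norm_sub_add_norm_sub _ (r * AddCircle.toCircle x : ℂ) _).trans ?_
      rw [← hd]
      have : (r * AddCircle.toCircle x : ℂ) - AddCircle.toCircle x =
          ((r - 1 : ℝ) : ℂ) * AddCircle.toCircle x := by push_cast; ring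
      rw [this, norm_mul, Circle.norm_coe, mul_one, Complex.norm_real, Real.norm_eq_abs,
        abs_sub_comm, abs_of_nonneg (by linarith [hr.2])]
    have h4 := norm_toCircle_sub_one_ge (t - x)
    have h5 : (AddCircle.toCircle t : ℂ) - AddCircle.toCircle x =
        (AddCircle.toCircle (t - x) - 1) * AddCircle.toCircle x := by
      rw [sub_mul, one_mul, ← Circle.coe_mul, ← AddCircle.toCircle_add, sub_add_cancel]
    rw [h5, norm_mul, Circle.norm_coe, mul_one] at h3
    linarith
  have hd0 : 0 < d := lt_of_lt_of_le (by linarith [hr.2]) h1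
  have h6 : 1 - r ^ 2 ≤ 2 * (1 - r) := by nlinarith [sq_nonneg (1 - r)]
  have h7 : 0 ≤ 1 - r := by linarith [hr.2]
  rw [poissonKernel_toCircle, hrx, ← hd, div_mul_eq_mul_div, div_mul_eq_mul_div,
    div_le_iff₀ (by positivity), div_le_iff₀ (by positivity)]
  constructor
  · calc (1 - r ^ 2) * (1 - r) ≤ 2 * (1 - r) * (1 - r) := mul_le_mul_of_nonneg_right h6 h7
      _ = 2 * (1 - r) ^ 2 := by ring
      _ ≤ 2 * d ^ 2 := by gcongr
  · calc (1 - r ^ 2) * (2 * ‖t - x‖ ^ 2) ≤ 2 * (1 - r) * (2 * ‖t - x‖ ^ 2) :=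
          mul_le_mul_of_nonneg_right h6 (by positivity)
      _ = (1 - r) * (2 * ‖t - x‖) ^ 2 := by ring
      _ ≤ (1 - r) * d ^ 2 := by gcongr

/-- The Poisson kernel is dominated by a combination of normalized indicators of the balls of radius
`2ᵏ δ`, with geometrically decaying weights. -/
theorem exists_poissonKernel_le_dyadic {r : ℝ} (hr : r ∈ Ico (0 : ℝ) 1) (x t : UnitAddCircle) :
    ∃ k : ℕ, t ∈ Metric.closedBall x (2 ^ k * (1 - r)) ∧
      poissonKernel 0 (r * AddCircle.toCircle x) (AddCircle.toCircle t) ≤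
        2 / (4 ^ k * (1 - r)) := by
  have hδ : 0 < 1 - r := by linarith [hr.2]
  obtain ⟨h1, h2⟩ := poissonKernel_mul_le hr x t
  have hex : ∃ k : ℕ, ‖t - x‖ ≤ 2 ^ k * (1 - r) := by
    obtain ⟨k, hk⟩ := pow_unbounded_of_one_lt (‖t - x‖ / (1 - r)) one_lt_two
    exact ⟨k, ((div_lt_iff₀ hδ).1 hk).le⟩
  classical
  refine ⟨Nat.find hex, ?_, ?_⟩
  · rw [mem_closedBall_iff_norm]
    exact Nat.find_spec hex
  · cases hk : Nat.find hex with
    | zero => rw [pow_zero, one_mul]; exact (le_div_iff₀ hδ).2 h1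
    | succ k =>
      have h3 : 2 ^ k * (1 - r) < ‖t - x‖ := not_le.1 (Nat.find_min hex (by omega))
      have h4 : (2 ^ k * (1 - r)) ^ 2 ≤ ‖t - x‖ ^ 2 := by gcongr
      have hP : 0 ≤ poissonKernel 0 (r * AddCircle.toCircle x : ℂ) (AddCircle.toCircle t) := by
        refine poissonKernel_toCircle_nonneg ?_ t
        rw [norm_mul, Circle.norm_coe, mul_one, Complex.norm_real, Real.norm_of_nonneg hr.1]
        exact hr.2
      set P := poissonKernel 0 (r * AddCircle.toCircle x : ℂ) (AddCircle.toCircle t)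
      rw [le_div_iff₀ (by positivity)]
      have h5 : P * (2 * (2 ^ k * (1 - r)) ^ 2) ≤ 1 - r :=
        (mul_le_mul_of_nonneg_left (by linarith) hP).trans h2
      have h6 : ((2 : ℝ) ^ k) ^ 2 = 4 ^ k := by rw [← pow_mul, mul_comm, pow_mul]; norm_num
      have h7 : P * (2 * (2 ^ k * (1 - r)) ^ 2) = (P * (4 ^ (k + 1) * (1 - r)) / 2) * (1 - r) := by
        rw [mul_pow, h6]; ring
      rw [h7] at h5
      have h8 := le_of_mul_le_mul_right (h5.trans_eq (one_mul _).symm) hδ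
      linarith

/-- The Poisson integrals of a bounded function with vanishing averages at `x` tend to zero along
the radius through `e^{2πix}`. -/
theorem tendsto_integral_poissonKernel_mul {φ : UnitAddCircle → ℝ} {C : ℝ}
    (hφ : Integrable φ circleMeasure) (h0 : ∀ t, 0 ≤ φ t)
    (hC : ∀ᵐ t ∂circleMeasure, φ t ≤ C) {x : UnitAddCircle}
    (hx : Tendsto (fun s : ℝ => ⨍ t in Metric.closedBall x s, φ t ∂circleMeasure) (𝓝[>] 0)
      (𝓝 0)) :
    Tendsto (fun r : ℝ => ∫ t, poissonKernel 0 (r * AddCircle.toCircle x) (AddCircle.toCircle t) *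
      φ t ∂circleMeasure) (𝓝[<] 1) (𝓝 0) := by
  set A : ℝ → ℝ := fun s => ⨍ t in Metric.closedBall x s, φ t ∂circleMeasure with hA
  have hball : ∀ s : ℝ, 0 ≤ s → circleMeasure.real (Metric.closedBall x s) ≤ 2 * s := by
    intro s hs
    have h1 : circleMeasure (Metric.closedBall x s) = ENNReal.ofReal (min 1 (2 * s)) := by
      have h2 := AddCircle.volume_closedBall (T := 1) (x := x) s
      rwa [AddCircle.volume_eq_smul_haarAddCircle, ENNReal.ofReal_one, one_smul] at h2
    rw [measureReal_def, h1, ENNReal.toReal_ofReal (le_min zero_le_one (by linarith))]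
    exact min_le_right _ _
  have hint : ∀ s : ℝ, ∫ t in Metric.closedBall x s, φ t ∂circleMeasure =
      circleMeasure.real (Metric.closedBall x s) * A s := by
    intro s
    rw [hA, ← smul_eq_mul, measure_smul_setAverage _ (measure_ne_top _ _)]
  have hC0 : 0 ≤ C := by
    obtain ⟨t, ht⟩ := hC.exists
    exact (h0 t).trans ht
  have hA0 : ∀ s, 0 ≤ A s := fun s => by
    rw [hA]
    simp only [setAverage_eq, smul_eq_mul]
    exact mul_nonneg (inv_nonneg.2 measureReal_nonneg) (integral_nonneg h0)
  have hAC : ∀ s, A s ≤ C := by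
    intro s
    have h1 : ∫ t in Metric.closedBall x s, φ t ∂circleMeasure ≤
        C * circleMeasure.real (Metric.closedBall x s) := by
      refine (integral_mono_ae hφ.integrableOn (integrable_const C)
        (ae_restrict_of_ae hC)).trans ?_
      rw [setIntegral_const, smul_eq_mul, mul_comm]
    simp only [hA, setAverage_eq, smul_eq_mul]
    rcases (measureReal_nonneg (μ := circleMeasure) (s := Metric.closedBall x s)).eq_or_lt with h | h
    · rw [← h, inv_zero, zero_mul]; exact hC0
    · rwa [inv_mul_le_iff₀ h, mul_comm]
  -- The contribution of the `k`-th dyadic ball to the bound for the integral; it tends to zero for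
  -- each `k` and is dominated by a geometric series.
  set T : ℝ → ℕ → ℝ := fun r k => 2 / (4 ^ k * (1 - r)) *
    ∫ t in Metric.closedBall x (2 ^ k * (1 - r)), φ t ∂circleMeasure with hT
  have hTle : ∀ r ∈ Ico (0 : ℝ) 1, ∀ k, 0 ≤ T r k ∧
      T r k ≤ 4 * (1 / 2 : ℝ) ^ k * A (2 ^ k * (1 - r)) := by
    intro r hr k
    have hδ : 0 < 1 - r := by linarith [hr.2]
    refine ⟨mul_nonneg (by positivity) (integral_nonneg h0), ?_⟩
    have h24 : (4 : ℝ) ^ k = 2 ^ k * 2 ^ k := by rw [← mul_pow]; norm_num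
    simp only [hT, hint]
    rw [← mul_assoc]
    refine mul_le_mul_of_nonneg_right ?_ (hA0 _)
    refine (mul_le_mul_of_nonneg_left (hball _ (by positivity)) (by positivity)).trans_eq ?_
    rw [h24, one_div, inv_pow]
    field_simp
    norm_num
  have hgeo : Summable fun k : ℕ => 4 * (1 / 2 : ℝ) ^ k * C :=
    ((summable_geometric_of_lt_one (by norm_num) (by norm_num)).mul_left 4).mul_right C
  have hTb : ∀ r ∈ Ico (0 : ℝ) 1, ∀ k, ‖T r k‖ ≤ 4 * (1 / 2 : ℝ) ^ k * C := by
    intro r hr k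
    rw [Real.norm_of_nonneg (hTle r hr k).1]
    exact (hTle r hr k).2.trans (mul_le_mul_of_nonneg_left (hAC _) (by positivity))
  have hIco : ∀ᶠ r : ℝ in 𝓝[<] 1, r ∈ Ico (0 : ℝ) 1 := Ico_mem_nhdsLT zero_lt_one
  have hTlim : Tendsto (fun r => ∑' k, T r k) (𝓝[<] 1) (𝓝 0) := by
    rw [← tsum_zero (α := ℝ) (β := ℕ)]
    refine tendsto_tsum_of_dominated_convergence hgeo (fun k => ?_) (hIco.mono fun r hr k =>
      hTb r hr k)
    have h1 : Tendsto (fun r : ℝ => 2 ^ k * (1 - r)) (𝓝[<] 1) (𝓝[>] 0) := by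
      refine tendsto_nhdsWithin_iff.2 ⟨?_, ?_⟩
      · have : Tendsto (fun r : ℝ => 2 ^ k * (1 - r)) (𝓝 1) (𝓝 (2 ^ k * (1 - 1))) := by
          refine Continuous.tendsto ?_ 1
          fun_prop
        rw [sub_self, mul_zero] at this
        exact this.mono_left nhdsWithin_le_nhds
      · filter_upwards [self_mem_nhdsWithin] with r hr
        have : r < 1 := hr
        have h2 : 0 < 1 - r := by linarith
        exact mul_pos (pow_pos two_pos k) h2
    have h2 := (hx.comp h1).const_mul (4 * (1 / 2 : ℝ) ^ k)
    rw [mul_zero] at h2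
    exact tendsto_of_tendsto_of_tendsto_of_le_of_le' tendsto_const_nhds h2
      (hIco.mono fun r hr => (hTle r hr k).1) (hIco.mono fun r hr => (hTle r hr k).2)
  have hrx : ∀ r ∈ Ico (0 : ℝ) 1, ‖(r * AddCircle.toCircle x : ℂ)‖ < 1 := by
    intro r hr
    rw [norm_mul, Circle.norm_coe, mul_one, Complex.norm_real, Real.norm_of_nonneg hr.1]
    exact hr.2
  refine tendsto_of_tendsto_of_tendsto_of_le_of_le' tendsto_const_nhds hTlim
    (hIco.mono fun r hr => integral_nonneg fun t =>
      mul_nonneg (poissonKernel_toCircle_nonneg (hrx r hr) t) (h0 t))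
    (hIco.mono fun r hr => ?_)
  have hδ : 0 < 1 - r := by linarith [hr.2]
  set G : ℕ → UnitAddCircle → ℝ := fun k t => 2 / (4 ^ k * (1 - r)) *
    (Metric.closedBall x (2 ^ k * (1 - r))).indicator φ t with hG
  have hGi : ∀ k, Integrable (G k) circleMeasure := fun k =>
    (hφ.indicator Metric.isClosed_closedBall.measurableSet).const_mul _
  have hG0 : ∀ k t, 0 ≤ G k t := fun k t =>
    mul_nonneg (by positivity) (indicator_nonneg (fun t _ => h0 t) t)
  have hGT : ∀ k, ∫ t, G k t ∂circleMeasure = T r k := fun k => by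
    simp only [hG, hT]
    rw [integral_const_mul, integral_indicator Metric.isClosed_closedBall.measurableSet]
  have hGn : ∀ k, ∫ t, ‖G k t‖ ∂circleMeasure = T r k := fun k => by
    rw [← hGT]
    exact integral_congr_ae (Eventually.of_forall fun t => Real.norm_of_nonneg (hG0 k t))
  have hsT : Summable fun k => ∫ t, ‖G k t‖ ∂circleMeasure := by
    simp only [hGn]
    exact Summable.of_norm_bounded hgeo (hTb r hr)
  have hGb : ∀ k t, G k t ≤ 2 / (1 - r) * (1 / 4 : ℝ) ^ k * φ t := by
    intro k t
    refine mul_le_mul ?_ (indicator_le_self' (fun _ _ => h0 _) t)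
      (indicator_nonneg (fun t _ => h0 t) t) (by positivity)
    rw [one_div, inv_pow]
    exact le_of_eq (by field_simp)
  have hgeo4 : Summable fun k : ℕ => 2 / (1 - r) * (1 / 4 : ℝ) ^ k :=
    (summable_geometric_of_lt_one (by norm_num) (by norm_num)).mul_left _
  have hsG : ∀ t, Summable fun k => G k t := fun t =>
    Summable.of_nonneg_of_le (fun k => hG0 k t) (fun k => hGb k t) (hgeo4.mul_right (φ t))
  have hGs := hasSum_integral_of_summable_integral_norm hGi hsT
  simp only [hGT] at hGs
  rw [hGs.tsum_eq]
  have hGsi : Integrable (fun t => ∑' k, G k t) circleMeasure := by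
    refine (hφ.const_mul (∑' k : ℕ, 2 / (1 - r) * (1 / 4 : ℝ) ^ k)).mono' ?_
      (Eventually.of_forall fun t => ?_)
    · refine aestronglyMeasurable_of_tendsto_ae atTop
        (f := fun m t => ∑ k ∈ Finset.range m, G k t)
        (fun m => Finset.aestronglyMeasurable_fun_sum _ fun k _ => (hGi k).aestronglyMeasurable)
        (Eventually.of_forall fun t => (hsG t).hasSum.tendsto_sum_nat)
    · rw [Real.norm_of_nonneg (tsum_nonneg fun k => hG0 k t), ← tsum_mul_right]
      exact (hsG t).tsum_le_tsum (fun k => hGb k t) (hgeo4.mul_right (φ t))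
  refine integral_mono (integrable_poissonKernel_mul (hrx r hr) hφ) hGsi fun t => ?_
  obtain ⟨k, hk1, hk2⟩ := exists_poissonKernel_le_dyadic hr x t
  refine le_trans ?_ ((hsG t).le_tsum k fun j _ => hG0 j t)
  simp only [hG, indicator_of_mem hk1]
  exact mul_le_mul_of_nonneg_right hk2 (h0 t)

/-- The radial limits of a function in `H²(𝔻)` with bounded boundary value exist almost everywhere
and agree with the boundary value: this holds at the Lebesgue points of the boundary value. -/
theorem ae_tendsto_radial (f : H2 1) {C : ℝ} (hf : ∀ᵐ t ∂circleMeasure, ‖boundary f t‖ ≤ C) :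
    ∀ᵐ x ∂circleMeasure, Tendsto (fun r : ℝ => f fun _ => r * (AddCircle.toCircle x : ℂ)) (𝓝[<] 1)
      (𝓝 (boundary f x)) := by
  have hvol : (volume : Measure UnitAddCircle) = circleMeasure := by
    rw [AddCircle.volume_eq_smul_haarAddCircle]; simp
  have hloc : LocallyIntegrable (boundary f) (volume : Measure UnitAddCircle) := by
    rw [hvol]; exact (integrable_boundary f).locallyIntegrable
  have hleb := IsUnifLocDoublingMeasure.ae_tendsto_average_norm_sub
    (volume : Measure UnitAddCircle) hloc 1
  rw [hvol] at hleb
  filter_upwards [hleb] with x hx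
  have hx' := hx (l := 𝓝[>] (0 : ℝ)) (fun _ => x) (fun s => s) tendsto_id (by
    filter_upwards [self_mem_nhdsWithin] with s hs
    refine Metric.mem_closedBall_self ?_
    rw [one_mul]
    exact le_of_lt hs)
  have hint : Integrable (fun t => ‖boundary f t - boundary f x‖) circleMeasure :=
    ((integrable_boundary f).sub (integrable_const _)).norm
  have hlim := tendsto_integral_poissonKernel_mul (C := C + ‖boundary f x‖) hint
    (fun t => norm_nonneg _) (by
      filter_upwards [hf] with t ht
      exact (norm_sub_le _ _).trans (by linarith)) hx'
  rw [tendsto_iff_norm_sub_tendsto_zero]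
  refine tendsto_of_tendsto_of_tendsto_of_le_of_le' tendsto_const_nhds hlim
    (Eventually.of_forall fun r => norm_nonneg _) ?_
  filter_upwards [Ico_mem_nhdsLT (zero_lt_one (α := ℝ))] with r hr
  have hz : ‖(r * AddCircle.toCircle x : ℂ)‖ < 1 := by
    rw [norm_mul, Circle.norm_coe, mul_one, Complex.norm_real, Real.norm_of_nonneg hr.1]
    exact hr.2
  have hPi : Integrable (fun t => (poissonKernel 0 (r * AddCircle.toCircle x : ℂ)
      (AddCircle.toCircle t) : ℂ)) circleMeasure :=
    (Complex.continuous_ofReal.comp (continuous_poissonKernel hz)).integrable_of_hasCompactSupport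
      (HasCompactSupport.of_compactSpace _)
  have hPf : Integrable (fun t => (poissonKernel 0 (r * AddCircle.toCircle x : ℂ)
      (AddCircle.toCircle t) : ℂ) * boundary f t) circleMeasure := by
    obtain ⟨B, hB⟩ := isCompact_univ.exists_bound_of_continuousOn
      (Complex.continuous_ofReal.comp (continuous_poissonKernel hz)).continuousOn
    exact (integrable_boundary f).bdd_mul hPi.aestronglyMeasurable
      (Eventually.of_forall fun t => hB t (mem_univ t))
  have h1 : boundary f x = ∫ t, (poissonKernel 0 (r * AddCircle.toCircle x : ℂ)
      (AddCircle.toCircle t) : ℂ) * boundary f x ∂circleMeasure := by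
    rw [integral_mul_const, integral_complex_ofReal, integral_poissonKernel hz, Complex.ofReal_one,
      one_mul]
  have h2 : (f fun _ => (r * AddCircle.toCircle x : ℂ)) - boundary f x =
      ∫ t, ((poissonKernel 0 (r * AddCircle.toCircle x : ℂ) (AddCircle.toCircle t) : ℂ) *
        boundary f t - (poissonKernel 0 (r * AddCircle.toCircle x : ℂ) (AddCircle.toCircle t) : ℂ) *
        boundary f x) ∂circleMeasure := by
    rw [integral_sub hPf (hPi.mul_const _), ← h1, ← eq_integral_poissonKernel f hz]
  rw [h2]
  refine norm_integral_le_of_norm_le (integrable_poissonKernel_mul hz hint)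
    (Eventually.of_forall fun t => ?_)
  rw [← mul_sub, norm_mul, Complex.norm_real,
    Real.norm_of_nonneg (poissonKernel_toCircle_nonneg hz t)]

/-! ### Multiplication by bounded holomorphic functions -/

theorem radialMean_mul_le {Θ : ℂ → ℂ} (hd : DifferentiableOn ℂ Θ (Metric.ball 0 1))
    (hb : ∀ z ∈ Metric.ball (0 : ℂ) 1, ‖Θ z‖ ≤ 1) (f : H2 1) {r : ℝ} (hr : r ∈ Ico (0 : ℝ) 1) :
    radialMean (n := 1) (fun z => Θ (z 0) * f z) r ≤ radialMean f r := by
  have hm : ∀ t, torusPoint (n := 1) (fun _ => r) t 0 ∈ Metric.ball (0 : ℂ) 1 := fun t =>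
    mem_ball_zero_iff.2 (torusPoint_mem (fun _ => hr) t 0)
  have hc : Continuous fun t => f (torusPoint (fun _ => r) t) :=
    continuous_comp_torusPoint f.mem.differentiableOn.continuousOn fun _ => hr
  have hp : Continuous fun t => Θ (torusPoint (n := 1) (fun _ => r) t 0) :=
    hd.continuousOn.comp_continuous
      ((continuous_apply (0 : Fin 1)).comp (continuous_torusPoint fun _ => r)) hm
  refine integral_mono
    (Continuous.integrable_of_hasCompactSupport ((hp.mul hc).norm.pow 2)
      (HasCompactSupport.of_compactSpace _))
    (Continuous.integrable_of_hasCompactSupport (hc.norm.pow 2)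
      (HasCompactSupport.of_compactSpace _)) fun t => ?_
  refine pow_le_pow_left₀ (norm_nonneg _) ?_ 2
  rw [norm_mul]
  exact mul_le_of_le_one_left (norm_nonneg _) (hb _ (hm t))

theorem memH2_mul {Θ : ℂ → ℂ} (hd : DifferentiableOn ℂ Θ (Metric.ball 0 1))
    (hb : ∀ z ∈ Metric.ball (0 : ℂ) 1, ‖Θ z‖ ≤ 1) (f : H2 1) :
    MemH2 (n := 1) fun z => Θ (z 0) * f z where
  differentiableOn := by
    refine DifferentiableOn.mul (hd.comp (f := fun z : Fin 1 → ℂ => z 0) (by fun_prop)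
      fun z hz => mem_ball_zero_iff.2 (hz 0)) f.mem.differentiableOn
  eq_zero_off z hz := by rw [f.mem.eq_zero_off z hz, mul_zero]
  bddAbove := by
    obtain ⟨B, hB⟩ := f.mem.bddAbove
    refine ⟨B, ?_⟩
    rintro _ ⟨r, hr, rfl⟩
    exact (radialMean_mul_le hd hb f hr).trans (hB ⟨r, hr, rfl⟩)

/-- Multiplication by a holomorphic function bounded by `1`, as an operator on `H²(𝔻)`. -/
def mulOp {Θ : ℂ → ℂ} (hd : DifferentiableOn ℂ Θ (Metric.ball 0 1))
    (hb : ∀ z ∈ Metric.ball (0 : ℂ) 1, ‖Θ z‖ ≤ 1) : H2 1 →L[ℂ] H2 1 :=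
  LinearMap.mkContinuous
    { toFun := fun f => ⟨fun z => Θ (z 0) * f z, memH2_mul hd hb f⟩
      map_add' := fun f g => Subtype.ext (funext fun z => mul_add (Θ (z 0)) (f z) (g z))
      map_smul' := fun c f => Subtype.ext (funext fun z => mul_left_comm (Θ (z 0)) c (f z)) } 1 (by
    intro f
    rw [one_mul, norm_def, norm_def]
    refine Real.sqrt_le_sqrt (ciSup_mono ?_ fun r => radialMean_mul_le hd hb f r.2)
    refine f.mem.bddAbove.mono ?_
    rintro _ ⟨r, rfl⟩
    exact ⟨r, r.2, rfl⟩)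

theorem mulOp_apply {Θ : ℂ → ℂ} (hd : DifferentiableOn ℂ Θ (Metric.ball 0 1))
    (hb : ∀ z ∈ Metric.ball (0 : ℂ) 1, ‖Θ z‖ ≤ 1) (f : H2 1) (z : Fin 1 → ℂ) :
    mulOp hd hb f z = Θ (z 0) * f z := rfl

/-! ### Invariant subspaces of the shift -/

theorem shift_pow_apply (k : ℕ) (f : H2 1) (z : Fin 1 → ℂ) : (shift ^ k) f z = z 0 ^ k * f z := by
  induction k with
  | zero => rw [pow_zero, pow_zero, one_mul]; rfl
  | succ k ih =>
    rw [pow_succ', mul_apply_eq_comp, coordMul_apply, ih, pow_succ', mul_assoc]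

theorem zPow_apply (m : ℕ) {z : Fin 1 → ℂ} (hz : z ∈ polydisc 1) : zPow m z = z 0 ^ m := by
  rw [zPow, monomial_apply _ hz, Fin.prod_univ_one]

/-- A nonzero invariant subspace of the shift has a nonzero wandering vector, since otherwise all its
elements would vanish to infinite order at the origin. -/
theorem exists_wandering {M : ClosedSubmodule ℂ (H2 1)} (hM : ∀ f ∈ M, shift f ∈ M)
    (h0 : ∃ f ∈ M, f ≠ 0) : ∃ θ ∈ M, ‖θ‖ = 1 ∧ ∀ f ∈ M, inner ℂ (shift f) θ = (0 : ℂ) := by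
  by_contra! hcon
  set N : ClosedSubmodule ℂ (H2 1) := M.map shift with hN
  have hSN : ∀ f ∈ M, shift f ∈ N := fun f hf =>
    ClosedSubmodule.map_le_iff_le_comap.1 (le_refl (M.map shift)) hf
  have hNM : N ≤ M := ClosedSubmodule.map_le_iff_le_comap.2 hM
  have hMN : M ≤ N := by
    intro f hf
    by_contra hfN
    set g := f - proj N f with hg
    have hgM : g ∈ M := M.toSubmodule.sub_mem hf (hNM (proj_mem N f))
    have hg0 : g ≠ 0 := fun h => hfN (mem_of_proj_eq N (sub_eq_zero.1 h).symm)
    obtain ⟨u, hu, hu'⟩ := hcon ((‖g‖⁻¹ : ℂ) • g) (M.toSubmodule.smul_mem _ hgM)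
      (norm_smul_inv_norm hg0)
    refine hu' ?_
    rw [inner_smul_right, inner_sub_proj N f (hSN u hu), mul_zero]
  have hz : ∀ m : ℕ, ∀ f ∈ M, inner ℂ (zPow m) f = (0 : ℂ) := by
    intro m
    have hle : ∀ m : ℕ, (∀ f ∈ M, inner ℂ (zPow m) (shift f) = (0 : ℂ)) →
        ∀ f ∈ M, inner ℂ (zPow m) f = (0 : ℂ) := by
      intro m h f hf
      have h1 : N ≤ ⟨(ℂ ∙ zPow m)ᗮ, Submodule.isClosed_orthogonal _⟩ :=
        ClosedSubmodule.map_le_iff_le_comap.2 fun f hf =>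
          Submodule.mem_orthogonal_singleton_iff_inner_right.2 (h f hf)
      exact Submodule.mem_orthogonal_singleton_iff_inner_right.1 (h1 (hMN hf))
    induction m with
    | zero =>
      refine hle 0 fun f _ => ?_
      rw [zPow, inner_monomial]
      have h1 := hasSum_taylor (shift f) (z := 0) fun i => by simp
      have h2 := hasSum_single (f := fun k : Fin 1 → ℕ => taylorCoeff (shift f) k *
        ∏ i, (0 : Fin 1 → ℂ) i ^ k i) (fun _ => 0) fun k hk => by
          have : k 0 ≠ 0 := fun h => hk (funext fun i => by rw [Subsingleton.elim i 0]; exact h)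
          simp [this]
      have h3 := h1.unique h2
      rw [coordMul_apply] at h3
      simpa using h3.symm
    | succ m ih =>
      refine hle _ fun f hf => ?_
      rw [← shift_zPow, ← ContinuousLinearMap.adjoint_inner_right, adjoint_coordMul_coordMul]
      exact ih f hf
  obtain ⟨f, hf, hf0⟩ := h0
  exact hf0 (ext_inner_zPow fun m => by rw [hz m f hf, inner_zero_right])

/-- The boundary value of a unit wandering vector is unimodular: the Fourier coefficients of
`|θ|² - 1` vanish. -/
theorem norm_boundary_eq_one {θ : H2 1} (h1 : ‖θ‖ = 1)
    (h : ∀ k : ℕ, 1 ≤ k → inner ℂ ((shift ^ k) θ) θ = (0 : ℂ)) :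
    ∀ᵐ t ∂circleMeasure, ‖boundary θ t‖ = 1 := by
  set W : UnitAddCircle → ℂ := fun t => starRingEnd ℂ (boundary θ t) * boundary θ t with hW
  have hWi : Integrable W circleMeasure := by
    refine (L2.integrable_inner (𝕜 := ℂ) (boundary θ) (boundary θ)).congr
      (Eventually.of_forall fun t => ?_)
    simp only [hW, RCLike.inner_apply]
    exact mul_comm _ _
  have hneg : ∀ k : ℕ, ∫ t, fourier (-(k : ℤ)) t * W t ∂circleMeasure = if k = 0 then 1 else 0 := by
    intro k
    have h2 := (inner_shift_pow k θ θ).symm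
    split_ifs with hk
    · subst hk
      refine h2.trans ?_
      rw [pow_zero, one_apply_eq_self, inner_self_eq_norm_sq_to_K, h1]
      simp
    · exact h2.trans (h k (by omega))
  have hWc : ∀ t, starRingEnd ℂ (W t) = W t := fun t => by
    simp only [hW, map_mul, Complex.conj_conj]; ring
  have hpos : ∀ k : ℕ, ∫ t, fourier (k : ℤ) t * W t ∂circleMeasure = if k = 0 then 1 else 0 := by
    intro k
    have h2 := congrArg (starRingEnd ℂ) (hneg k)
    rw [← integral_conj] at h2
    simp only [map_mul, hWc, ← fourier_neg, neg_neg] at h2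
    rw [h2]
    split_ifs <;> simp
  have hall : ∀ k : ℤ, ∫ t, fourier k t * W t ∂circleMeasure = if k = 0 then 1 else 0 := by
    intro k
    obtain ⟨m, rfl | rfl⟩ := k.eq_nat_or_neg
    · simpa using hpos m
    · simpa using hneg m
  have hone : ∀ k : ℤ, ∫ t, fourier k t ∂circleMeasure = if k = 0 then (1 : ℂ) else 0 := by
    intro k
    have h2 := congrFun (fourierCoeff_fourier (T := 1) k) 0
    rw [fourierCoeff] at h2
    simp only [neg_zero, fourier_zero, one_smul] at h2
    rw [h2, Pi.single_apply]
    exact if_congr eq_comm rfl rfl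
  have hz := ae_eq_zero_of_integral_fourier_mul (hWi.sub (integrable_const (1 : ℂ))) fun k => by
    have hi : Integrable (fun t => fourier k t * W t) circleMeasure :=
      hWi.bdd_mul (map_continuous (fourier k)).aestronglyMeasurable
        (Eventually.of_forall fun t => (fourier k).norm_coe_le_norm t)
    have hf : Integrable (fun t => fourier (T := 1) k t) circleMeasure :=
      (map_continuous (fourier k)).integrable_of_hasCompactSupport
        (HasCompactSupport.of_compactSpace _)
    simp only [Pi.sub_apply, mul_sub, mul_one]
    rw [integral_sub hi hf, hall, hone, sub_self]
  filter_upwards [hz] with t ht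
  have h2 : W t - 1 = 0 := ht
  have h3 : ((‖boundary θ t‖ ^ 2 : ℝ) : ℂ) = 1 := by
    rw [← sub_eq_zero, ← h2, ← Complex.normSq_eq_norm_sq, Complex.normSq_eq_conj_mul_self]
  have h4 : ‖boundary θ t‖ ^ 2 = 1 := by exact_mod_cast h3
  exact (pow_eq_one_iff_of_nonneg (norm_nonneg _) two_ne_zero).1 h4

/-- The only vector `h` orthogonal to all `z^k θ`, for which moreover `θ` is orthogonal to all
`z^{k+1} h`, is zero: the Fourier coefficients of `h` times the conjugate of `θ` vanish. -/
theorem eq_zero_of_inner_shift_pow {θ h : H2 1} (hθ : ∀ᵐ t ∂circleMeasure, ‖boundary θ t‖ = 1)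
    (h1 : ∀ k : ℕ, inner ℂ ((shift ^ k) θ) h = (0 : ℂ))
    (h2 : ∀ k : ℕ, 1 ≤ k → inner ℂ ((shift ^ k) h) θ = (0 : ℂ)) : h = 0 := by
  set W : UnitAddCircle → ℂ := fun t => starRingEnd ℂ (boundary θ t) * boundary h t with hW
  have hWi : Integrable W circleMeasure := by
    refine (L2.integrable_inner (𝕜 := ℂ) (boundary θ) (boundary h)).congr
      (Eventually.of_forall fun t => ?_)
    simp only [hW, RCLike.inner_apply]
    exact mul_comm _ _
  have hz := ae_eq_zero_of_integral_fourier_mul hWi fun k => by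
    rcases le_or_gt k 0 with hk | hk
    · obtain ⟨m, rfl⟩ := Int.exists_eq_neg_ofNat hk
      exact (inner_shift_pow m θ h).symm.trans (h1 m)
    · lift k to ℕ using hk.le
      have h3 := congrArg (starRingEnd ℂ)
        ((inner_shift_pow k h θ).symm.trans (h2 k (by omega)))
      rw [← integral_conj, map_zero] at h3
      rw [← h3]
      refine integral_congr_ae (Eventually.of_forall fun t => ?_)
      simp only [hW, map_mul, ← fourier_neg, neg_neg, Complex.conj_conj]
      ring
  have hb : boundary h = 0 := by
    refine Lp.ext ?_
    filter_upwards [hz, hθ, Lp.coeFn_zero ℂ 2 circleMeasure] with t ht hθt h0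
    rw [h0]
    refine (mul_eq_zero.1 (show W t = 0 from ht)).resolve_left fun h => ?_
    rw [map_eq_zero] at h
    rw [h, norm_zero] at hθt
    exact zero_ne_one hθt
  exact boundary.injective (hb.trans (map_zero _).symm)

/-- **Beurling's theorem** in terms of backward shift invariant subspaces. Since only the orthogonal
complement of `Θ H²(𝔻)` matters, it suffices that `Θ H²(𝔻)` is dense in `Rᗮ`. -/
theorem exists_eq_modelSpace {R : ClosedSubmodule ℂ (H2 1)}
    (hR : ∀ f ∈ R, shift.adjoint f ∈ R) :
    ∃ Θ : ℂ → ℂ, (IsHInfty Θ ∧ (IsInner Θ ∨ ∀ z ∈ Metric.ball (0 : ℂ) 1, Θ z = 0)) ∧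
      R = modelSpace Θ := by
  by_cases h0 : ∃ f ∈ Rᗮ, f ≠ 0
  · have hM : ∀ f ∈ Rᗮ, shift f ∈ Rᗮ := fun f hf => isQuotientModule_iff.2
      (fun i g hg => by rw [Subsingleton.elim i 0]; exact hR g hg) 0 f hf
    have hMk : ∀ f ∈ Rᗮ, ∀ k : ℕ, (shift ^ k) f ∈ Rᗮ := fun f hf k =>
      pow_apply_mem (V := Rᗮ.toSubmodule) (fun f hf => hM f hf) k hf
    obtain ⟨θ, hθM, hθ1, hθ⟩ := exists_wandering hM h0
    have hwander : ∀ f ∈ Rᗮ, ∀ k : ℕ, 1 ≤ k → inner ℂ ((shift ^ k) f) θ = (0 : ℂ) := by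
      intro f hf k hk
      obtain ⟨k, rfl⟩ := Nat.exists_eq_add_of_le' hk
      rw [pow_succ', mul_apply_eq_comp]
      exact hθ _ (hMk f hf k)
    have hbd := norm_boundary_eq_one hθ1 (hwander θ hθM)
    set Θ : ℂ → ℂ := fun w => θ fun _ => w with hΘ
    have hd : DifferentiableOn ℂ Θ (Metric.ball 0 1) :=
      θ.mem.differentiableOn.comp (f := fun w : ℂ => fun _ : Fin 1 => w) (by fun_prop)
        fun w hw _ => mem_ball_zero_iff.1 hw
    have hb : ∀ z ∈ Metric.ball (0 : ℂ) 1, ‖Θ z‖ ≤ 1 := fun z hz =>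
      norm_le_one_of_boundary θ (hbd.mono fun t ht => ht.le) (mem_ball_zero_iff.1 hz)
    have hin : IsInner Θ := by
      refine ⟨⟨hd, 1, hb⟩, ?_⟩
      filter_upwards [hbd, ae_tendsto_radial θ (hbd.mono fun t ht => ht.le)] with t h1 h2
      exact ⟨boundary θ t, h1, h2⟩
    have hmulz : ∀ m, mulOp hd hb (zPow m) = (shift ^ m) θ := fun m => H2.ext fun z hz => by
      have hz0 : (fun _ => z 0) = z := funext fun i => congrArg z (Subsingleton.elim 0 i)
      rw [mulOp_apply, zPow_apply m hz, shift_pow_apply, mul_comm]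
      simp only [hΘ, hz0]
    have hsub : ∀ g ∈ multRange Θ, g ∈ Rᗮ := by
      rintro g ⟨f, hf⟩
      have hg : g = mulOp hd hb f := H2.ext fun z hz => hf z hz
      have hmem : f ∈ Rᗮ.comap (mulOp hd hb) := mem_of_monomial_mem (fun k => by
        rw [ClosedSubmodule.mem_comap, monomial_one, hmulz]
        exact hMk θ hθM _) f
      rw [hg]
      exact hmem
    refine ⟨Θ, ⟨hin.toIsHInfty, .inl hin⟩, le_antisymm (fun x hx => ?_) fun x hx => ?_⟩
    · refine (Submodule.mem_orthogonal _ _).2 fun g hg => ?_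
      exact Submodule.inner_left_of_mem_orthogonal (K := R.toSubmodule) hx (hsub g hg)
    · -- The component of `x` orthogonal to `R` is orthogonal to all `z^k θ`, so it vanishes.
      have hy : x - proj R x ∈ Rᗮ := (Submodule.mem_orthogonal _ _).2 fun u hu =>
        inner_sub_proj R x hu
      have hy0 : x - proj R x = 0 := by
        refine eq_zero_of_inner_shift_pow hbd (fun k => ?_) (hwander _ hy)
        have hk : (shift ^ k) θ ∈ multRange Θ :=
          ⟨zPow k, fun z hz => by rw [← hmulz, mulOp_apply]⟩
        rw [inner_sub_right, Submodule.inner_right_of_mem_orthogonal hk hx, zero_sub, neg_eq_zero]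
        exact Submodule.inner_left_of_mem_orthogonal (K := R.toSubmodule) (proj_mem R x)
          (hsub _ hk)
      exact mem_of_proj_eq R (sub_eq_zero.1 hy0).symm
  · push Not at h0
    refine ⟨fun _ => 0, ⟨⟨differentiableOn_const 0, 0, fun z _ => by simp⟩, .inr fun _ _ => rfl⟩,
      le_antisymm (fun x hx => ?_) fun x hx => ?_⟩
    · refine (Submodule.mem_orthogonal _ _).2 ?_
      rintro g ⟨f, hf⟩
      have : g = 0 := H2.ext fun z hz => (hf z hz).trans (zero_mul _)
      rw [this, inner_zero_left]
    · have hy : x - proj R x ∈ Rᗮ := (Submodule.mem_orthogonal _ _).2 fun u hu =>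
        inner_sub_proj R x hu
      exact mem_of_proj_eq R (sub_eq_zero.1 (h0 _ hy)).symm

theorem adjoint_shift_mem_modelSpace (Θ : ℂ → ℂ) {f : H2 1} (hf : f ∈ modelSpace Θ) :
    shift.adjoint f ∈ modelSpace Θ := by
  refine (Submodule.mem_orthogonal _ _).2 ?_
  rintro g ⟨u, hu⟩
  rw [ContinuousLinearMap.adjoint_inner_right]
  refine Submodule.inner_right_of_mem_orthogonal (K := multRange Θ) ⟨shift u, fun z hz => ?_⟩ hf
  rw [coordMul_apply, coordMul_apply, hu z hz, mul_left_comm]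

end Hardy

end

theorem mainTheorem2 (n : ℕ) (hn : 1 ≤ n) (Q : ClosedSubmodule ℂ (Hardy.H2 n)) :
    (Hardy.IsQuotientModule Q ∧ Hardy.IsDoublyCommuting Q) ↔
      ∃ Θ : Fin n → ℂ → ℂ,
        (∀ i, Hardy.IsHInfty (Θ i) ∧
          (Hardy.IsInner (Θ i) ∨ ∀ z ∈ Metric.ball (0 : ℂ) 1, Θ i z = 0)) ∧
        Q = Hardy.tensor fun i => Hardy.modelSpace (Θ i) := by
  constructor
  · rintro ⟨hQ, hD⟩
    have hQ' := Hardy.isQuotientModule_iff.1 hQ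
    have h := Hardy.eq_tensor_sliceSpace hn hQ' ((Hardy.isDoublyCommuting_iff hQ).1 hD)
    choose Θ hΘ hR using fun i => Hardy.exists_eq_modelSpace fun f =>
      Hardy.adjoint_shift_mem_sliceSpace hQ' i (x := f)
    refine ⟨Θ, hΘ, h.trans ?_⟩
    exact congrArg Hardy.tensor (funext hR)
  · rintro ⟨Θ, -, rfl⟩
    have h := fun i f => Hardy.adjoint_shift_mem_modelSpace (Θ i) (f := f)
    exact ⟨Hardy.isQuotientModule_tensor h, Hardy.isDoublyCommuting_tensor h⟩
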